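/- Let $d\ge 1$. For an open set $\Omega\subset\mathbb R^d$ let $h^2(\Omega)$ be the harmonic Bergman space, i.e. the space of complex-valued functions in $L^2(\Omega)$ (with respect to Lebesgue measure) that are harmonic on $\Omega$, with the inner product $(f,g)=\int_\Omega f\overline g\,dx$. For $k\ge 0$ let $N_d(k)$ be the dimension of the complex vector space of spherical harmonics of degree $k$ (the restrictions to the unit sphere of $\mathbb R^d$ of the homogeneous harmonic polynomials of degree $k$ with complex coefficients), and put $h_d(k)=N_d(0)+\dots+N_d(k)$ and $h_d(-1)=0$. Let $B=\{y\in\mathbb R^d: |y-x|<r\}$ with $x\in\mathbb R^d$, $r>0$, let $\gamma>1$, and let $B(\gamma)=\{y: |y-x|<\gamma r\}$. Then $h^2(B(\gamma))$ and $h^2(B)$ are Hilbert spaces, the restriction $J:h^2(B(\gamma))\to h^2(B)$, $Jf=f|_B$, is compact, and its singular values $s_n(J)=\sqrt{\lambda_n(J^*J)}$, $n\ge 1$ (where $\lambda_1(J^*J)\ge\lambda_2(J^*J)\ge\cdots$ are the nonzero eigenvalues repeated according to multiplicity, followed by zeros if there are only finitely many), are given by $$s_n(J)=\gamma^{-(k+d/2)}\qquad\text{for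 } h_d(k-1)<n\le h_d(k),\quad k=0,1,2,\dots$$ For $d\ge 2$ every $n\ge1$ lies in one of these ranges; for $d=1$ exactly $n=1,2$ do, and $s_n(J)=0$ for $n\ge 3$. In particular, for each $k\ge 0$ the number of indices $n$ with $s_n(J)=\gamma^{-(k+d/2)}$ is $N_d(k)$. Moreover $h_d(k)$ is the dimension of the space of harmonic polynomials on $\mathbb R^d$ (with complex coefficients) of degree at most $k$, for every $k\ge 0$. -/

import Mathlib

open MeasureTheory InnerProductSpace

noncomputable section

/-! ### Eigenvalue sequences and singular values of compact operators -/

/-- `l` is the eigenvalue sequence `λ_1, λ_2, …` of `A`: the nonzero eigenvalues of `A`, each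
repeated according to its algebraic multiplicity (the dimension of the generalised eigenspace
`⋃ m, ker (A - μ) ^ m`) and ordered by decreasing magnitude; if there are only finitely many of
them, the sequence continues with zeros. -/
def IsEigenvalueSequence {H : Type*} [NormedAddCommGroup H] [InnerProductSpace ℂ H]
    (A : H →L[ℂ] H) (l : ℕ+ → ℂ) : Prop :=
  Antitone (fun n => ‖l n‖) ∧
    ∀ μ : ℂ, μ ≠ 0 →
      {n : ℕ+ | l n = μ}.encard =
        Cardinal.toENat (Module.rank ℂ (Module.End.maxGenEigenspace (A : H →ₗ[ℂ] H) μ))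

/-- `s` is the sequence of singular values `s_1, s_2, …` of the compact operator `A` between
Hilbert spaces: `s_n` is the nonnegative square root of `λ_n(A* A)`. -/
def IsSingularValueSequence {H₁ H₂ : Type*}
    [NormedAddCommGroup H₁] [InnerProductSpace ℂ H₁] [CompleteSpace H₁]
    [NormedAddCommGroup H₂] [InnerProductSpace ℂ H₂] [CompleteSpace H₂]
    (A : H₁ →L[ℂ] H₂) (s : ℕ+ → ℝ) : Prop :=
  IsCompactOperator A ∧
    ∃ l : ℕ+ → ℂ, IsEigenvalueSequence (ContinuousLinearMap.adjoint A ∘L A) l ∧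
      ∀ n, 0 ≤ s n ∧ (s n : ℂ) ^ 2 = l n

/-! ### Harmonic Bergman spaces -/

/-- The harmonic Bergman space `h²(Ω)`: the classes in `L²(Ω)` (complex valued, with respect to
Lebesgue measure) of functions that are harmonic on `Ω`, with the inner product of `L²(Ω)`. -/
def harmonicBergman {d : ℕ} (Ω : Set (EuclideanSpace ℝ (Fin d))) :
    Submodule ℂ (Lp ℂ 2 (volume.restrict Ω)) where
  carrier := {f | ∃ u : EuclideanSpace ℝ (Fin d) → ℂ,
    HarmonicOnNhd u Ω ∧ f =ᵐ[volume.restrict Ω] u}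
  zero_mem' := ⟨fun _ => 0, harmonicOnNhd_const 0, Lp.coeFn_zero _ _ _⟩
  add_mem' := by
    rintro f g ⟨u, hu, hfu⟩ ⟨v, hv, hgv⟩
    exact ⟨u + v, hu.add hv, (Lp.coeFn_add f g).trans (hfu.add hgv)⟩
  smul_mem' := by
    rintro c f ⟨u, hu, hfu⟩
    refine ⟨c • u, ?_, (Lp.coeFn_smul c f).trans (hfu.const_smul c)⟩
    exact hu.comp_CLM (ContinuousLinearMap.mul ℝ ℂ c)

/-- Restriction `L²(Ω₁) → L²(Ω₂)` for `Ω₂ ⊆ Ω₁`. -/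
def restrictL2 {d : ℕ} {Ω₁ Ω₂ : Set (EuclideanSpace ℝ (Fin d))} (h : Ω₂ ⊆ Ω₁) :
    Lp ℂ 2 (volume.restrict Ω₁) →L[ℂ] Lp ℂ 2 (volume.restrict Ω₂) :=
  LinearMap.mkContinuous
    { toFun := fun f => ((Lp.memLp f).mono_measure (Measure.restrict_mono h le_rfl)).toLp f
      map_add' := fun f g => by
        rw [← MemLp.toLp_add]
        exact MemLp.toLp_congr _ _
          (ae_mono (Measure.restrict_mono h le_rfl) (Lp.coeFn_add f g))
      map_smul' := fun c f => by
        rw [RingHom.id_apply, ← MemLp.toLp_const_smul]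
        exact MemLp.toLp_congr _ _
          (ae_mono (Measure.restrict_mono h le_rfl) (Lp.coeFn_smul c f)) }
    1
    (fun f => by
      rw [one_mul]
      change ‖MemLp.toLp f ((Lp.memLp f).mono_measure (Measure.restrict_mono h le_rfl))‖ ≤ _
      rw [Lp.norm_toLp, Lp.norm_def]
      exact ENNReal.toReal_mono (Lp.eLpNorm_ne_top f)
        (eLpNorm_mono_measure _ (Measure.restrict_mono h le_rfl)))

theorem restrictL2_mem {d : ℕ} {Ω₁ Ω₂ : Set (EuclideanSpace ℝ (Fin d))} (h : Ω₂ ⊆ Ω₁)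
    (f : Lp ℂ 2 (volume.restrict Ω₁)) (hf : f ∈ harmonicBergman Ω₁) :
    restrictL2 h f ∈ harmonicBergman Ω₂ := by
  obtain ⟨u, hu, hfu⟩ := hf
  exact ⟨u, hu.mono h, (MemLp.coeFn_toLp
    ((Lp.memLp f).mono_measure (Measure.restrict_mono h le_rfl))).trans
    (ae_mono (Measure.restrict_mono h le_rfl) hfu)⟩

/-- The canonical identification `J : h²(Ω₁) → h²(Ω₂)`, `f ↦ f|_{Ω₂}`, for `Ω₂ ⊆ Ω₁`. -/
def canonicalIdentification {d : ℕ} {Ω₁ Ω₂ : Set (EuclideanSpace ℝ (Fin d))} (h : Ω₂ ⊆ Ω₁) :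
    harmonicBergman Ω₁ →L[ℂ] harmonicBergman Ω₂ :=
  ((restrictL2 h).comp (harmonicBergman Ω₁).subtypeL).codRestrict (harmonicBergman Ω₂)
    (fun f => restrictL2_mem h f f.2)

/-! ### Harmonic polynomials and spherical harmonics -/

/-- The complex polynomials in `d` variables whose polynomial function on `ℝ^d` is harmonic. -/
def harmonicPolynomials (d : ℕ) : Submodule ℂ (MvPolynomial (Fin d) ℂ) where
  carrier := {p | HarmonicOnNhd
    (fun x : EuclideanSpace ℝ (Fin d) => MvPolynomial.aeval (fun i => (x i : ℂ)) p) Set.univ}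
  zero_mem' := by simp
  add_mem' := by
    intro p q hp hq
    simp only [Set.mem_ofPred_eq, map_add]
    exact hp.add hq
  smul_mem' := by
    intro c p hp
    simp only [Set.mem_ofPred_eq, map_smul]
    exact hp.comp_CLM (ContinuousLinearMap.mul ℝ ℂ c)

/-- Restriction of a polynomial function to the unit sphere of `ℝ^d`. -/
def restrictToSphere (d : ℕ) : MvPolynomial (Fin d) ℂ →ₗ[ℂ]
    (Metric.sphere (0 : EuclideanSpace ℝ (Fin d)) 1 → ℂ) :=
  LinearMap.pi fun ξ =>
    (MvPolynomial.aeval (fun i => ((ξ : EuclideanSpace ℝ (Fin d)) i : ℂ))).toLinearMap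

/-- The spherical harmonics of degree `k`: restrictions to the unit sphere of the homogeneous
harmonic polynomials of degree `k`. -/
def sphericalHarmonics (d k : ℕ) :
    Submodule ℂ (Metric.sphere (0 : EuclideanSpace ℝ (Fin d)) 1 → ℂ) :=
  (harmonicPolynomials d ⊓ MvPolynomial.homogeneousSubmodule (Fin d) ℂ k).map
    (restrictToSphere d)

/-- `N_d(k)`, the number of linearly independent spherical harmonics of degree `k`. -/
def sphericalHarmonicsDim (d k : ℕ) : ℕ :=
  Module.finrank ℂ (sphericalHarmonics d k)

/-- `h_d(k) = N_d(0) + ⋯ + N_d(k)`, with `h_d(-1) = 0`. -/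
def harmonicDim (d : ℕ) (k : ℤ) : ℕ :=
  ∑ l ∈ Finset.range (k + 1).toNat, sphericalHarmonicsDim d l

end

/-!
Write `w = R² - |y - c|²` for a ball of radius `R` about `c`. The homogeneous harmonic polynomials
in `y - c` diagonalise `J* J`: those of degree `k` form an eigenspace with eigenvalue
`γ ^ (-(2 k + d))`, the ratio of the squared norms of such a polynomial over the two balls. Three
facts are needed.

* Orthogonality of different degrees (`integral_ball_mul_eq_zero_of_isHomogeneous`). For harmonic
  `p`, `q` homogeneous of degrees `k ≠ l`, the divergence of `w (q ∇p - p ∇q)` is a nonzero multiple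
  of `p q` by Euler's identity, and the divergence theorem applies because `w` vanishes on the
  sphere. The only form of the divergence theorem used is `integral_ball_fderiv_weight_smul_eq_zero`,
  and surface integrals never occur.
* Totality (`ae_eq_zero_of_forall_integral_harmonic_eq_zero`). Every polynomial is a sum `h + Δ (w² g)`
  with `h` harmonic (`exists_harmonic_add_polyLaplacian`): `g ↦ Δ Δ (w² g)` is injective and does not
  raise degrees, hence is bijective on the polynomials of bounded degree. A function in `h²` is
  orthogonal to `Δ (w² g)` by Green's formula on slightly smaller balls
  (`integral_ball_mul_polyLaplacian_eq_zero`). If it is orthogonal to the harmonic polynomials, then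
  it is orthogonal to all polynomials, and vanishes by the Stone-Weierstrass theorem.
* Completeness of `h²` (`isClosed_harmonicBergman`). A mean value property with a radial bump function
  as weight (`integral_ball_weight_mul_harmonic`) shows that an `L²` limit of harmonic functions is
  `C²`, and Green's formula shows that its Laplacian vanishes.

The rest is abstract. An operator satisfying `IsDiagonalFor` with weights decreasing to zero is
compact, and the eigenspaces of `J* J` are the given subspaces; a decreasing sequence is determined
by the multiplicities of its nonzero values (`eq_of_multiplicities`). Restriction to the sphere is
injective on homogeneous polynomials, so the multiplicities are the `N_d(k)`; they are positive for
`d ≥ 2` and equal to `1, 1, 0, 0, …` for `d = 1`. The sum over the homogeneous components gives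
the dimension of the space of harmonic polynomials of bounded degree.
-/

/-! ### Integrals of derivatives over a ball -/

section BallIntegral

open Metric Filter Topology

variable {E G : Type*} [NormedAddCommGroup E] [InnerProductSpace ℝ E]

theorem hasDerivAt_max_zero_rpow {a : ℝ} (ha : 0 < a) (t : ℝ) :
    HasDerivAt (fun s : ℝ => (max s 0) ^ (1 + a)) ((1 + a) * (max t 0) ^ a) t := by
  rcases lt_trichotomy t 0 with h | rfl | h
  · rw [max_eq_right h.le, Real.zero_rpow ha.ne', mul_zero]
    refine (hasDerivAt_const t (0 : ℝ)).congr_of_eventuallyEq ?_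
    filter_upwards [eventually_lt_nhds h] with s hs
    rw [max_eq_right hs.le, Real.zero_rpow (by positivity)]
  · rw [max_self, Real.zero_rpow ha.ne', mul_zero, hasDerivAt_iff_isLittleO_nhds_zero]
    have h0 : (0 : ℝ) ^ (1 + a) = 0 := Real.zero_rpow (by positivity)
    simp only [zero_add, max_self, h0, sub_zero, smul_zero]
    have h1 : (fun h : ℝ => |h| ^ a) =o[𝓝 0] fun _ => (1 : ℝ) := by
      rw [Asymptotics.isLittleO_one_iff]
      have : ContinuousAt (fun h : ℝ => |h| ^ a) 0 :=
        continuous_abs.continuousAt.rpow_const (Or.inr ha.le)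
      simpa [ContinuousAt, Real.zero_rpow ha.ne'] using this
    have h2 := (Asymptotics.isBigO_refl (fun h : ℝ => h) (𝓝 0)).mul_isLittleO h1
    simp only [mul_one] at h2
    refine Asymptotics.IsBigO.trans_isLittleO (Asymptotics.IsBigO.of_bound 1 ?_) h2
    refine Eventually.of_forall fun s => ?_
    rw [one_mul, norm_mul, Real.norm_of_nonneg (by positivity : 0 ≤ |s| ^ a), Real.norm_eq_abs s,
      Real.norm_of_nonneg (by positivity)]
    rcases le_or_gt s 0 with hs | hs
    · rw [max_eq_right hs, h0]; positivity
    · rw [max_eq_left hs.le, abs_of_pos hs, Real.rpow_add hs, Real.rpow_one]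
  · rw [max_eq_left h.le]
    have := Real.hasDerivAt_rpow_const (x := t) (p := 1 + a) (Or.inl h.ne')
    rw [add_sub_cancel_left] at this
    refine this.congr_of_eventuallyEq ?_
    filter_upwards [eventually_gt_nhds h] with s hs
    rw [max_eq_left hs.le]

theorem hasFDerivAt_sq_sub_norm_sub_sq (c y : E) (ρ : ℝ) :
    HasFDerivAt (fun z : E => ρ ^ 2 - ‖z - c‖ ^ 2) (-((2 : ℝ) • innerSL ℝ (y - c))) y := by
  have := ((hasFDerivAt_id y).sub_const c).norm_sq
  refine (this.const_sub (ρ ^ 2)).congr_fderiv ?_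
  ext w
  simp [two_smul]

variable [FiniteDimensional ℝ E] [MeasurableSpace E] [BorelSpace E]
  [NormedAddCommGroup G] [NormedSpace ℝ G]

/-- A form of the divergence theorem: a function which vanishes on the boundary of a ball has
derivatives of mean zero over the ball. Replacing the weight by its powers of exponent `1 + a`,
`a > 0`, extended by zero, gives compactly supported `C¹` functions on the whole space;
then `a → 0`. -/
theorem integral_ball_fderiv_weight_smul_eq_zero (μ : Measure E) [μ.IsAddHaarMeasure]
    {c : E} {ρ : ℝ} {U : Set E} (hU : IsOpen U)
    (hsub : closedBall c ρ ⊆ U) {F : E → G} (hF : ContDiffOn ℝ 1 F U) (v : E) :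
    ∫ y in ball c ρ, fderiv ℝ (fun z => (ρ ^ 2 - ‖z - c‖ ^ 2) • F z) y v ∂μ = 0 := by
  rcases le_or_gt ρ 0 with hρ | hρ
  · simp [ball_eq_empty.2 hρ]
  set s : E → ℝ := fun y => ρ ^ 2 - ‖y - c‖ ^ 2 with hs
  have hscont : Continuous s := by fun_prop
  have hsout : ∀ y, y ∉ ball c ρ → s y ≤ 0 := by
    intro y hy
    rw [mem_ball, dist_eq_norm, not_lt] at hy
    have := pow_le_pow_left₀ hρ.le hy 2
    simp only [hs]; linarith
  have hsin : ∀ y ∈ ball c ρ, 0 < s y := by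
    intro y hy
    rw [mem_ball, dist_eq_norm] at hy
    have := pow_lt_pow_left₀ hy (norm_nonneg _) two_ne_zero
    simp only [hs]; linarith
  have hFd : ∀ y ∈ U, HasFDerivAt F (fderiv ℝ F y) y := fun y hy =>
    ((hF.differentiableOn one_ne_zero).differentiableAt (hU.mem_nhds hy)).hasFDerivAt
  have hFc : ContinuousOn F U := hF.continuousOn
  have hF'c : ContinuousOn (fun y => fderiv ℝ F y v) U :=
    (hF.continuousOn_fderiv_of_isOpen hU le_rfl).clm_apply continuousOn_const
  -- the derivative in the direction `v` of the regularised function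
  let D : ℝ → E → G := fun a y =>
    ((max (s y) 0) ^ (1 + a)) • fderiv ℝ F y v +
      (((1 + a) * (max (s y) 0) ^ a) * (-2 * ⟪y - c, v⟫_ℝ)) • F y
  have hDline : ∀ a > 0, ∀ y, HasLineDerivAt ℝ (fun z => ((max (s z) 0) ^ (1 + a)) • F z)
      (D a y) y v := by
    intro a ha y
    by_cases hy : y ∈ U
    · have h1 := (hasDerivAt_max_zero_rpow ha (s y)).comp_hasFDerivAt y
        (hasFDerivAt_sq_sub_norm_sub_sq c y ρ)
      have h2 := (h1.smul (hFd y hy)).hasLineDerivAt v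
      refine h2.congr_deriv ?_
      simp [D, mul_assoc, inner_sub_left]
    · have hyb : y ∉ closedBall c ρ := fun h => hy (hsub h)
      have hy0 : s y ≤ 0 := hsout y fun h => hyb (ball_subset_closedBall h)
      have hD0 : D a y = 0 := by
        simp only [D, max_eq_right hy0, Real.zero_rpow ha.ne',
          Real.zero_rpow (by positivity : (1 : ℝ) + a ≠ 0)]
        simp
      rw [hD0]
      have : HasFDerivAt (fun z => ((max (s z) 0) ^ (1 + a)) • F z) (0 : E →L[ℝ] G) y := by
        refine (hasFDerivAt_const (0 : G) y).congr_of_eventuallyEq ?_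
        filter_upwards [isClosed_closedBall.isOpen_compl.mem_nhds hyb] with z hz
        have hz0 : s z ≤ 0 := hsout z fun h => hz (ball_subset_closedBall h)
        rw [max_eq_right hz0, Real.zero_rpow (by positivity), zero_smul]
      simpa using this.hasLineDerivAt v
  have hDout : ∀ a > 0, ∀ y ∉ ball c ρ, D a y = 0 := by
    intro a ha y hy
    simp only [D, max_eq_right (hsout y hy), Real.zero_rpow ha.ne',
      Real.zero_rpow (by positivity : (1 : ℝ) + a ≠ 0)]
    simp
  have hDcont : ∀ a > 0, ContinuousOn (D a) (closedBall c ρ) := by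
    intro a ha
    have e1 : Continuous fun y => (max (s y) 0) ^ (1 + a) :=
      (hscont.max continuous_const).rpow_const fun _ => Or.inr (by positivity)
    have e2 : Continuous fun y => (max (s y) 0) ^ a :=
      (hscont.max continuous_const).rpow_const fun _ => Or.inr ha.le
    refine (e1.continuousOn.smul (hF'c.mono hsub)).add
      (ContinuousOn.smul (Continuous.continuousOn ?_) (hFc.mono hsub))
    fun_prop
  have hKc : IsCompact (closedBall c ρ) := isCompact_closedBall c ρ
  have hDint : ∀ a > 0, ∫ y in ball c ρ, D a y ∂μ = 0 := by
    intro a ha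
    rw [setIntegral_eq_integral_of_forall_compl_eq_zero (hDout a ha)]
    have hi : Integrable (D a) μ := by
      rw [← integrableOn_iff_integrable_of_support_subset (s := closedBall c ρ)]
      · exact (hDcont a ha).integrableOn_compact hKc
      · intro y hy
        by_contra h
        exact hy (hDout a ha y fun h' => h (ball_subset_closedBall h'))
    have hi0 : Integrable (fun z => ((max (s z) 0) ^ (1 + a)) • F z) μ := by
      rw [← integrableOn_iff_integrable_of_support_subset (s := closedBall c ρ)]
      · refine ContinuousOn.integrableOn_compact hKc ?_
        exact ((hscont.max continuous_const).rpow_const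
          fun _ => Or.inr (by positivity)).continuousOn.smul (hFc.mono hsub)
      · intro y hy
        by_contra h
        refine hy ?_
        simp only [max_eq_right (hsout y fun h' => h (ball_subset_closedBall h')),
          Real.zero_rpow (by positivity : (1 : ℝ) + a ≠ 0), zero_smul]
    have := integral_bilinear_hasLineDerivAt_right_eq_neg_left_of_integrable (μ := μ)
      (f := fun _ : E => (1 : ℝ)) (f' := fun _ => 0) (v := v)
      (B := ContinuousLinearMap.lsmul ℝ ℝ) (g := fun z => ((max (s z) 0) ^ (1 + a)) • F z)
      (g' := D a) (by simp) (by simpa using hi) (by simpa using hi0)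
      (fun x _ => by simpa using (hasFDerivAt_const (1 : ℝ) x).hasLineDerivAt v)
      (fun x _ => hDline a ha x)
    simpa using this
  -- passage to the limit `a → 0`
  have hlim : Tendsto (fun n : ℕ => ∫ y in ball c ρ, D (1 / ((n : ℝ) + 1)) y ∂μ) atTop
      (𝓝 (∫ y in ball c ρ, fderiv ℝ (fun z => s z • F z) y v ∂μ)) := by
    refine tendsto_integral_of_dominated_convergence
      (fun y => ((1 + ρ ^ 2) * ρ ^ 2) * ‖fderiv ℝ F y v‖ +
        ((2 * (1 + ρ ^ 2)) * (2 * |⟪y - c, v⟫_ℝ|)) * ‖F y‖) ?_ ?_ ?_ ?_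
    · intro n
      exact ((hDcont _ (by positivity)).mono ball_subset_closedBall).aestronglyMeasurable
        measurableSet_ball
    · refine IntegrableOn.mono_set (t := closedBall c ρ) ?_ ball_subset_closedBall
      refine ContinuousOn.integrableOn_compact hKc ?_
      refine (continuousOn_const.mul (hF'c.mono hsub).norm).add
        (ContinuousOn.mul (Continuous.continuousOn ?_) (hFc.mono hsub).norm)
      fun_prop
    · intro n
      refine (ae_restrict_mem measurableSet_ball).mono fun y hy => ?_
      have hy0 := hsin y hy
      have hyρ : s y ≤ ρ ^ 2 := by simp only [hs]; nlinarith [sq_nonneg ‖y - c‖]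
      set a : ℝ := 1 / ((n : ℝ) + 1) with ha
      have ha0 : 0 < a := by positivity
      have ha1 : a ≤ 1 := by
        rw [ha, div_le_one (by positivity)]; linarith [(Nat.cast_nonneg n : (0 : ℝ) ≤ n)]
      have hp : (s y) ^ a ≤ 1 + ρ ^ 2 := calc
        (s y) ^ a ≤ (1 + ρ ^ 2) ^ a := Real.rpow_le_rpow hy0.le (by linarith) ha0.le
        _ ≤ (1 + ρ ^ 2) ^ (1 : ℝ) :=
          Real.rpow_le_rpow_of_exponent_le (by nlinarith [sq_nonneg ρ]) ha1
        _ = _ := Real.rpow_one _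
      have hp0 : 0 ≤ (s y) ^ a := Real.rpow_nonneg hy0.le a
      simp only [D, max_eq_left hy0.le]
      refine (norm_add_le _ _).trans (add_le_add ?_ ?_)
      · rw [norm_smul, Real.norm_of_nonneg (by positivity), add_comm 1 a,
          Real.rpow_add_one hy0.ne']
        gcongr
      · rw [norm_smul, norm_mul, norm_mul, norm_mul, Real.norm_of_nonneg (by positivity : 0 ≤ 1 + a),
          Real.norm_of_nonneg hp0]
        gcongr
        · linarith
        · norm_num
        · exact le_rfl
    · refine (ae_restrict_mem measurableSet_ball).mono fun y hy => ?_
      have hy0 := hsin y hy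
      have hy' := hsub (ball_subset_closedBall hy)
      have hd := ((hasFDerivAt_sq_sub_norm_sub_sq c y ρ).smul (hFd y hy')).fderiv
      have hda : fderiv ℝ (fun z => s z • F z) y v =
          ((s y) ^ (1 + (0 : ℝ))) • fderiv ℝ F y v +
            (((1 + (0 : ℝ)) * (s y) ^ (0 : ℝ)) * (-2 * ⟪y - c, v⟫_ℝ)) • F y := by
        rw [show fderiv ℝ (fun z => s z • F z) y = _ from hd]
        simp [hs, inner_sub_left]
      rw [hda]
      simp only [D, max_eq_left hy0.le]
      have ht : Tendsto (fun n : ℕ => 1 / ((n : ℝ) + 1)) atTop (𝓝 0) :=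
        tendsto_one_div_add_atTop_nhds_zero_nat
      have t1 : Tendsto (fun n : ℕ => (s y) ^ (1 + 1 / ((n : ℝ) + 1))) atTop
          (𝓝 ((s y) ^ (1 + (0 : ℝ)))) :=
        (Real.continuousAt_const_rpow hy0.ne').tendsto.comp (tendsto_const_nhds.add ht)
      have t2 : Tendsto (fun n : ℕ => (s y) ^ (1 / ((n : ℝ) + 1))) atTop
          (𝓝 ((s y) ^ (0 : ℝ))) := (Real.continuousAt_const_rpow hy0.ne').tendsto.comp ht
      exact (t1.smul_const _).add ((((tendsto_const_nhds.add ht).mul t2).mul_const _).smul_const _)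
  refine tendsto_nhds_unique hlim ?_
  rw [tendsto_congr fun n : ℕ => hDint (1 / ((n : ℝ) + 1)) (by positivity)]
  exact tendsto_const_nhds

end BallIntegral

/-! ### Polynomial functions and the Laplacian in coordinates -/

section Polynomials

open Metric Filter Topology MvPolynomial Laplacian

variable {d : ℕ}

/-- The polynomial function `y ↦ p (y - c)` on `ℝ^d`. -/
noncomputable def polyFun (c : EuclideanSpace ℝ (Fin d)) (p : MvPolynomial (Fin d) ℂ)
    (y : EuclideanSpace ℝ (Fin d)) : ℂ :=
  aeval (fun i => (((y - c) i : ℝ) : ℂ)) p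

@[simp] theorem polyFun_add (c : EuclideanSpace ℝ (Fin d)) (p q : MvPolynomial (Fin d) ℂ)
    (y : EuclideanSpace ℝ (Fin d)) : polyFun c (p + q) y = polyFun c p y + polyFun c q y :=
  map_add _ _ _

@[simp] theorem polyFun_sub (c : EuclideanSpace ℝ (Fin d)) (p q : MvPolynomial (Fin d) ℂ)
    (y : EuclideanSpace ℝ (Fin d)) : polyFun c (p - q) y = polyFun c p y - polyFun c q y :=
  map_sub _ _ _

@[simp] theorem polyFun_mul (c : EuclideanSpace ℝ (Fin d)) (p q : MvPolynomial (Fin d) ℂ)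
    (y : EuclideanSpace ℝ (Fin d)) : polyFun c (p * q) y = polyFun c p y * polyFun c q y :=
  map_mul _ _ _

@[simp] theorem polyFun_C (c : EuclideanSpace ℝ (Fin d)) (a : ℂ)
    (y : EuclideanSpace ℝ (Fin d)) : polyFun c (C a) y = a := by
  simp [polyFun]

@[simp] theorem polyFun_X (c : EuclideanSpace ℝ (Fin d)) (i : Fin d)
    (y : EuclideanSpace ℝ (Fin d)) : polyFun c (X i) y = ((y i - c i : ℝ) : ℂ) := by
  simp [polyFun]

@[simp] theorem polyFun_zero (c : EuclideanSpace ℝ (Fin d))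
    (y : EuclideanSpace ℝ (Fin d)) : polyFun c 0 y = 0 := map_zero _

@[simp] theorem polyFun_smul (c : EuclideanSpace ℝ (Fin d)) (a : ℂ) (p : MvPolynomial (Fin d) ℂ)
    (y : EuclideanSpace ℝ (Fin d)) : polyFun c (a • p) y = a * polyFun c p y := by
  simp [polyFun]

@[simp] theorem polyFun_sum {ι : Type*} (c : EuclideanSpace ℝ (Fin d)) (s : Finset ι)
    (p : ι → MvPolynomial (Fin d) ℂ) (y : EuclideanSpace ℝ (Fin d)) :
    polyFun c (∑ i ∈ s, p i) y = ∑ i ∈ s, polyFun c (p i) y :=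
  map_sum _ _ _

theorem contDiff_polyFun (c : EuclideanSpace ℝ (Fin d)) (p : MvPolynomial (Fin d) ℂ)
    {n : WithTop ℕ∞} : ContDiff ℝ n (polyFun c p) := by
  induction p using MvPolynomial.induction_on with
  | C a => simpa [funext (polyFun_C c a)] using! contDiff_const
  | add p q hp hq => simpa [funext (polyFun_add c p q)] using! hp.add hq
  | mul_X p i hp =>
    have h : polyFun c (p * X i) = fun y => polyFun c p y * ((y i - c i : ℝ) : ℂ) := by
      funext y; simp
    rw [h]
    exact hp.mul (Complex.ofRealCLM.contDiff.comp
      (((EuclideanSpace.proj i : EuclideanSpace ℝ (Fin d) →L[ℝ] ℝ).contDiff).sub contDiff_const))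

theorem continuous_polyFun (c : EuclideanSpace ℝ (Fin d)) (p : MvPolynomial (Fin d) ℂ) :
    Continuous (polyFun c p) := (contDiff_polyFun c p (n := 0)).continuous

theorem differentiable_polyFun (c : EuclideanSpace ℝ (Fin d)) (p : MvPolynomial (Fin d) ℂ) :
    Differentiable ℝ (polyFun c p) := (contDiff_polyFun c p (n := 1)).differentiable one_ne_zero

theorem fderiv_polyFun_single (c : EuclideanSpace ℝ (Fin d)) (p : MvPolynomial (Fin d) ℂ)
    (y : EuclideanSpace ℝ (Fin d)) (i : Fin d) :
    fderiv ℝ (polyFun c p) y (EuclideanSpace.single i 1) = polyFun c (pderiv i p) y := by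
  induction p using MvPolynomial.induction_on with
  | C a => simp [show polyFun c (C a) = fun _ => a from funext (polyFun_C c a)]
  | add p q hp hq =>
    rw [show polyFun c (p + q) = fun z => polyFun c p z + polyFun c q z from
      funext (polyFun_add c p q), fderiv_fun_add (differentiable_polyFun c p y)
      (differentiable_polyFun c q y)]
    simp [hp, hq]
  | mul_X p j hp =>
    have hX : HasFDerivAt (fun z : EuclideanSpace ℝ (Fin d) => ((z j - c j : ℝ) : ℂ))
        (Complex.ofRealCLM.comp (EuclideanSpace.proj j : EuclideanSpace ℝ (Fin d) →L[ℝ] ℝ)) y :=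
      Complex.ofRealCLM.hasFDerivAt.comp y
        ((EuclideanSpace.proj j : EuclideanSpace ℝ (Fin d) →L[ℝ] ℝ).hasFDerivAt.sub_const _)
    have h : polyFun c (p * X j) = fun z => polyFun c p z * ((z j - c j : ℝ) : ℂ) := by
      funext z; simp
    rw [h, ((differentiable_polyFun c p y).hasFDerivAt.fun_mul hX).fderiv]
    simp only [Derivation.leibniz, pderiv_X, smul_eq_mul, polyFun_add, polyFun_mul, polyFun_X,
      add_apply, smul_apply, hp, ContinuousLinearMap.comp_apply]
    by_cases hij : i = j
    · subst hij; simp [polyFun]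
    · simp [Ne.symm hij]

/-- The Laplacian on polynomials. -/
noncomputable def polyLaplacian (d : ℕ) : MvPolynomial (Fin d) ℂ →ₗ[ℂ] MvPolynomial (Fin d) ℂ :=
  ∑ i, (pderiv i).toLinearMap ∘ₗ (pderiv i).toLinearMap

theorem polyLaplacian_apply (p : MvPolynomial (Fin d) ℂ) :
    polyLaplacian d p = ∑ i, pderiv i (pderiv i p) := by
  simp [polyLaplacian]

theorem laplacian_eq_sum_fderiv_fderiv {G : Type*} [NormedAddCommGroup G] [NormedSpace ℝ G]
    {f : EuclideanSpace ℝ (Fin d) → G} {x : EuclideanSpace ℝ (Fin d)} (hf : ContDiffAt ℝ 2 f x) :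
    Δ f x = ∑ i, fderiv ℝ (fun y => fderiv ℝ f y (EuclideanSpace.single i 1)) x
      (EuclideanSpace.single i 1) := by
  rw [laplacian_eq_iteratedFDeriv_orthonormalBasis f (EuclideanSpace.basisFun (Fin d) ℝ)]
  have hd : DifferentiableAt ℝ (fderiv ℝ f) x :=
    (hf.fderiv_right (m := 1) (by norm_num)).differentiableAt one_ne_zero
  refine Finset.sum_congr rfl fun i _ => ?_
  rw [iteratedFDeriv_two_apply, fderiv_clm_apply hd (differentiableAt_const _)]
  simp

theorem laplacian_polyFun (c : EuclideanSpace ℝ (Fin d)) (p : MvPolynomial (Fin d) ℂ) :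
    Δ (polyFun c p) = polyFun c (polyLaplacian d p) := by
  funext x
  rw [laplacian_eq_sum_fderiv_fderiv (contDiff_polyFun c p).contDiffAt, polyLaplacian_apply,
    polyFun_sum]
  simp_rw [fderiv_polyFun_single]

theorem eq_zero_of_polyFun_eqOn_ball {c : EuclideanSpace ℝ (Fin d)} {R : ℝ} (hR : 0 < R)
    {p : MvPolynomial (Fin d) ℂ} (h : ∀ y ∈ ball c R, polyFun c p y = 0) : p = 0 := by
  have hcont : ContinuousAt (fun t : Fin d → ℝ => c + WithLp.toLp 2 t) 0 := by fun_prop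
  have hmem : ∀ᶠ t in 𝓝 (0 : Fin d → ℝ), c + WithLp.toLp 2 t ∈ ball c R := by
    refine hcont.eventually_mem (isOpen_ball.mem_nhds ?_)
    simpa using hR
  obtain ⟨ε, hε, hball⟩ := Metric.eventually_nhds_iff_ball.1 hmem
  refine funext_set (fun _ => (fun t : ℝ => (t : ℂ)) '' Set.Ioo (-ε) ε)
    (fun i => (Set.Ioo_infinite (by linarith)).image Complex.ofReal_injective.injOn) ?_
  intro x hx
  choose t ht htx using fun i => hx i (Set.mem_univ i)
  have htb : t ∈ ball (0 : Fin d → ℝ) ε := by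
    rw [mem_ball_zero_iff, pi_norm_lt_iff hε]
    exact fun i => abs_lt.2 (ht i)
  have h1 := h _ (hball t htb)
  simp only [polyFun, add_sub_cancel_left] at h1
  have hxt : x = fun i => ((t i : ℝ) : ℂ) := funext fun i => (htx i).symm
  rw [hxt, map_zero, ← h1, aeval_eq_eval]

theorem mem_harmonicPolynomials_iff {p : MvPolynomial (Fin d) ℂ} :
    p ∈ harmonicPolynomials d ↔ polyLaplacian d p = 0 := by
  have h0 : (fun x : EuclideanSpace ℝ (Fin d) => aeval (fun i => (x i : ℂ)) p) = polyFun 0 p := by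
    funext x; simp [polyFun]
  have h1 : p ∈ harmonicPolynomials d ↔ HarmonicOnNhd (polyFun 0 p) Set.univ := by
    rw [← h0]; rfl
  rw [h1]
  constructor
  · intro h
    refine eq_zero_of_polyFun_eqOn_ball (c := 0) one_pos fun y _ => ?_
    rw [← laplacian_polyFun]
    exact (h y (Set.mem_univ y)).2.self_of_nhds
  · intro h y _
    refine ⟨(contDiff_polyFun 0 p).contDiffAt, ?_⟩
    rw [laplacian_polyFun, h]
    exact Eventually.of_forall fun z => polyFun_zero 0 z

theorem harmonicOnNhd_polyFun (c : EuclideanSpace ℝ (Fin d)) {p : MvPolynomial (Fin d) ℂ}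
    (hp : polyLaplacian d p = 0) (s : Set (EuclideanSpace ℝ (Fin d))) :
    HarmonicOnNhd (polyFun c p) s := by
  intro y _
  refine ⟨(contDiff_polyFun c p).contDiffAt, ?_⟩
  rw [laplacian_polyFun, hp]
  exact Eventually.of_forall fun z => polyFun_zero c z

/-- The polynomial `ρ² - ∑ Xᵢ²`. Its function in `y - c` is positive in the ball of radius `ρ` about
`c` and vanishes on the boundary. -/
noncomputable def ballWeight (d : ℕ) (ρ : ℝ) : MvPolynomial (Fin d) ℂ :=
  C ((ρ : ℂ) ^ 2) - ∑ i, X i ^ 2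

theorem polyFun_ballWeight (c : EuclideanSpace ℝ (Fin d)) (ρ : ℝ)
    (y : EuclideanSpace ℝ (Fin d)) :
    polyFun c (ballWeight d ρ) y = ((ρ ^ 2 - ‖y - c‖ ^ 2 : ℝ) : ℂ) := by
  rw [EuclideanSpace.norm_sq_eq]
  simp [ballWeight, pow_two]

theorem pderiv_ballWeight (ρ : ℝ) (i : Fin d) :
    pderiv i (ballWeight d ρ) = -2 * X i := by
  simp [ballWeight, pow_two, pderiv_X, Pi.single_apply, ← two_mul]

/-- Complex conjugation of the coefficients. -/
noncomputable def polyConj (p : MvPolynomial (Fin d) ℂ) : MvPolynomial (Fin d) ℂ :=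
  map (starRingEnd ℂ) p

theorem polyFun_polyConj (c : EuclideanSpace ℝ (Fin d)) (p : MvPolynomial (Fin d) ℂ)
    (y : EuclideanSpace ℝ (Fin d)) :
    polyFun c (polyConj p) y = starRingEnd ℂ (polyFun c p y) := by
  induction p using MvPolynomial.induction_on with
  | C a => simp [polyConj]
  | add p q hp hq => simp_all [polyConj]
  | mul_X p i hp => simp_all [polyConj]

theorem pderiv_polyConj (p : MvPolynomial (Fin d) ℂ) (i : Fin d) :
    pderiv i (polyConj p) = polyConj (pderiv i p) := pderiv_map

theorem polyLaplacian_polyConj (p : MvPolynomial (Fin d) ℂ) :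
    polyLaplacian d (polyConj p) = polyConj (polyLaplacian d p) := by
  simp only [polyLaplacian_apply, pderiv_polyConj]
  simp [polyConj]

theorem ballWeight_conj (ρ : ℝ) : polyConj (ballWeight d ρ) = ballWeight d ρ := by
  simp [polyConj, ballWeight]

end Polynomials

/-! ### Green's formula and the decomposition of polynomials -/

section Green

open Metric Filter Topology MvPolynomial Laplacian

variable {d : ℕ}

theorem integrableOn_ball_polyFun (c : EuclideanSpace ℝ (Fin d)) (R : ℝ)
    (p : MvPolynomial (Fin d) ℂ) : IntegrableOn (polyFun c p) (ball c R) :=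
  ((continuous_polyFun c p).continuousOn.integrableOn_compact
    (isCompact_closedBall c R)).mono_set ball_subset_closedBall

theorem integral_ball_pderiv_ballWeight_mul (c : EuclideanSpace ℝ (Fin d)) (R : ℝ)
    (p : MvPolynomial (Fin d) ℂ) (i : Fin d) :
    ∫ y in ball c R, polyFun c (pderiv i (ballWeight d R * p)) y = 0 := by
  rw [← integral_ball_fderiv_weight_smul_eq_zero volume isOpen_univ
    (Set.subset_univ (closedBall c R)) (contDiff_polyFun c p).contDiffOn
    (EuclideanSpace.single i (1 : ℝ))]
  congr 1
  funext y
  rw [← fderiv_polyFun_single]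
  congr 2
  funext z
  simp [polyFun_ballWeight]

/-- Green's second formula on a ball, for a `C²` function and a polynomial vanishing to second
order on the boundary of the ball. -/
theorem integral_ball_green {c : EuclideanSpace ℝ (Fin d)} {ρ : ℝ}
    {U : Set (EuclideanSpace ℝ (Fin d))} (hU : IsOpen U) (hsub : closedBall c ρ ⊆ U)
    {f : EuclideanSpace ℝ (Fin d) → ℂ} (hf : ContDiffOn ℝ 2 f U) (g : MvPolynomial (Fin d) ℂ) :
    ∫ y in ball c ρ, f y * polyFun c (polyLaplacian d (ballWeight d ρ ^ 2 * g)) y =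
      ∫ y in ball c ρ, polyFun c (ballWeight d ρ ^ 2 * g) y * Δ f y := by
  set w := ballWeight d ρ with hw
  set e : Fin d → EuclideanSpace ℝ (Fin d) := fun i => EuclideanSpace.single i 1 with he
  have hf' : ∀ i, ContDiffOn ℝ 1 (fun y => fderiv ℝ f y (e i)) U := fun i =>
    (hf.fderiv_of_isOpen hU (by norm_num)).clm_apply contDiffOn_const
  have hf'' : ∀ i, ContinuousOn (fun y => fderiv ℝ (fun z => fderiv ℝ f z (e i)) y (e i)) U :=
    fun i => ((hf' i).continuousOn_fderiv_of_isOpen hU le_rfl).clm_apply continuousOn_const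
  have hfd : ∀ y ∈ U, DifferentiableAt ℝ f y := fun y hy =>
    (hf.differentiableOn two_ne_zero).differentiableAt (hU.mem_nhds hy)
  have hf'd : ∀ i, ∀ y ∈ U, DifferentiableAt ℝ (fun y => fderiv ℝ f y (e i)) y := fun i y hy =>
    ((hf' i).differentiableOn one_ne_zero).differentiableAt (hU.mem_nhds hy)
  have hint : ∀ h : EuclideanSpace ℝ (Fin d) → ℂ, ContinuousOn h U → IntegrableOn h (ball c ρ) :=
    fun h hh => (ContinuousOn.integrableOn_compact (isCompact_closedBall c ρ)
      (hh.mono hsub)).mono_set ball_subset_closedBall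
  have hΔ : ∀ y ∈ U, Δ f y = ∑ i, fderiv ℝ (fun z => fderiv ℝ f z (e i)) y (e i) :=
    fun y hy => laplacian_eq_sum_fderiv_fderiv (hf.contDiffAt (hU.mem_nhds hy))
  have hballU : ball c ρ ⊆ U := ball_subset_closedBall.trans hsub
  -- the divergence theorem for the `i`-th component of `f ∇(w²g) - w²g ∇f`, a multiple of `w`
  have key : ∀ i, ∫ y in ball c ρ, (f y * polyFun c (pderiv i (pderiv i (w ^ 2 * g))) y -
      polyFun c (w ^ 2 * g) y * fderiv ℝ (fun z => fderiv ℝ f z (e i)) y (e i)) = 0 := by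
    intro i
    have hG : pderiv i (w ^ 2 * g) = w * (2 * pderiv i w * g + w * pderiv i g) := by
      simp only [pow_two, Derivation.leibniz, smul_eq_mul]; ring
    have hF : ContDiffOn ℝ 1 (fun y => f y * polyFun c (2 * pderiv i w * g + w * pderiv i g) y -
        polyFun c (w * g) y * fderiv ℝ f y (e i)) U :=
      ((hf.of_le (by norm_num)).mul (contDiff_polyFun c _).contDiffOn).sub
        ((contDiff_polyFun c _).contDiffOn.mul (hf' i))
    rw [← integral_ball_fderiv_weight_smul_eq_zero volume hU hsub hF (e i)]
    refine setIntegral_congr_fun measurableSet_ball fun y hy => ?_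
    have hyU := hballU hy
    have hfun : (fun z => (ρ ^ 2 - ‖z - c‖ ^ 2) •
        (f z * polyFun c (2 * pderiv i w * g + w * pderiv i g) z -
          polyFun c (w * g) z * fderiv ℝ f z (e i))) =
        fun z => f z * polyFun c (pderiv i (w ^ 2 * g)) z -
          polyFun c (w ^ 2 * g) z * fderiv ℝ f z (e i) := by
      funext z
      rw [hG, show w ^ 2 * g = w * (w * g) by ring, polyFun_mul c w (w * g),
        polyFun_mul c w (_ + _), hw, polyFun_ballWeight, Complex.real_smul]
      ring
    rw [hfun]
    have hd := ((hfd y hyU).hasFDerivAt.fun_mul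
      (differentiable_polyFun c (pderiv i (w ^ 2 * g)) y).hasFDerivAt).fun_sub
      ((differentiable_polyFun c (w ^ 2 * g) y).hasFDerivAt.fun_mul (hf'd i y hyU).hasFDerivAt)
    rw [hd.fderiv]
    simp only [sub_apply, add_apply, smul_apply, smul_eq_mul]
    rw [fderiv_polyFun_single, fderiv_polyFun_single]
    ring
  have hi1 : ∀ i, IntegrableOn (fun y => f y * polyFun c (pderiv i (pderiv i (w ^ 2 * g))) y)
      (ball c ρ) := fun i => hint _ (hf.continuousOn.mul (continuous_polyFun c _).continuousOn)
  have hi2 : ∀ i, IntegrableOn (fun y => polyFun c (w ^ 2 * g) y *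
      fderiv ℝ (fun z => fderiv ℝ f z (e i)) y (e i)) (ball c ρ) :=
    fun i => hint _ ((continuous_polyFun c _).continuousOn.mul (hf'' i))
  have e1 : ∫ y in ball c ρ, f y * polyFun c (polyLaplacian d (w ^ 2 * g)) y =
      ∑ i, ∫ y in ball c ρ, f y * polyFun c (pderiv i (pderiv i (w ^ 2 * g))) y := by
    rw [← integral_finsetSum _ fun i _ => hi1 i]
    simp_rw [polyLaplacian_apply, polyFun_sum, Finset.mul_sum]
  have e2 : ∫ y in ball c ρ, polyFun c (w ^ 2 * g) y * Δ f y =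
      ∑ i, ∫ y in ball c ρ, polyFun c (w ^ 2 * g) y *
        fderiv ℝ (fun z => fderiv ℝ f z (e i)) y (e i) := by
    rw [← integral_finsetSum _ fun i _ => hi2 i]
    refine setIntegral_congr_fun measurableSet_ball fun y hy => ?_
    simp only [hΔ y (hballU hy), Finset.mul_sum]
  rw [e1, e2]
  refine Finset.sum_congr rfl fun i _ => sub_eq_zero.1 ?_
  rw [← integral_sub (hi1 i) (hi2 i)]
  exact key i

/-- A harmonic function which is merely integrable on a ball is orthogonal to the Laplacians of
polynomials vanishing to second order on the boundary. Green's formula is applied on the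
concentric balls of radius `ρ < R`, with the polynomial adapted to `ρ`, and then `ρ → R`. -/
theorem integral_ball_mul_polyLaplacian_eq_zero {c : EuclideanSpace ℝ (Fin d)} {R : ℝ}
    {f : EuclideanSpace ℝ (Fin d) → ℂ} (hf : HarmonicOnNhd f (ball c R))
    (hfi : IntegrableOn f (ball c R)) (g : MvPolynomial (Fin d) ℂ) :
    ∫ y in ball c R, f y * polyFun c (polyLaplacian d (ballWeight d R ^ 2 * g)) y = 0 := by
  have hmulint : ∀ p, IntegrableOn (fun y => f y * polyFun c p y) (ball c R) := by
    intro p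
    obtain ⟨M, hM⟩ := (isCompact_closedBall c R).exists_bound_of_continuousOn
      (continuous_polyFun c p).continuousOn
    refine Integrable.mul_bdd (c := M) hfi (continuous_polyFun c p).aestronglyMeasurable ?_
    exact (ae_restrict_mem measurableSet_ball).mono fun y hy => hM y (ball_subset_closedBall hy)
  set ρ : ℕ → ℝ := fun n => R - 1 / ((n : ℝ) + 1) with hρ
  have hρR : ∀ n, ρ n < R := fun n => sub_lt_self _ (by positivity)
  have hρmono : Monotone ρ := fun m n hmn => sub_le_sub_left
    (one_div_le_one_div_of_le (by positivity) (by exact_mod_cast Nat.succ_le_succ hmn)) _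
  have hρlim : Tendsto ρ atTop (𝓝 R) := by
    simpa only [sub_zero] using tendsto_const_nhds (x := R).sub
      (tendsto_one_div_add_atTop_nhds_zero_nat (𝕜 := ℝ))
  have hUnion : ⋃ n, ball c (ρ n) = ball c R := by
    refine Set.Subset.antisymm (Set.iUnion_subset fun n => ball_subset_ball (hρR n).le) ?_
    intro y hy
    obtain ⟨n, hn⟩ := (hρlim.eventually (lt_mem_nhds (mem_ball.1 hy))).exists
    exact Set.mem_iUnion.2 ⟨n, hn⟩
  have hlim : ∀ p, Tendsto (fun n => ∫ y in ball c (ρ n), f y * polyFun c p y) atTop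
      (𝓝 (∫ y in ball c R, f y * polyFun c p y)) := by
    intro p
    have := tendsto_setIntegral_of_monotone (μ := volume) (f := fun y => f y * polyFun c p y)
      (s := fun n => ball c (ρ n)) (fun n => measurableSet_ball)
      (fun m n hmn => ball_subset_ball (hρmono hmn)) (by rw [hUnion]; exact hmulint p)
    rwa [hUnion] at this
  set τ : ℕ → ℂ := fun n => ((R : ℂ) ^ 2 - (ρ n : ℂ) ^ 2) with hτ
  have hτlim : Tendsto τ atTop (𝓝 0) := by
    have := tendsto_const_nhds (x := ((R : ℂ) ^ 2)) (f := atTop (α := ℕ)) |>.sub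
      (((Complex.continuous_ofReal.tendsto R).comp hρlim).pow 2)
    simpa using! this
  set w := ballWeight d R with hw
  -- the weight adapted to `ρ n` is `w - τ n`, so `Δ (weight² g)` is a quadratic polynomial in `τ n`
  have hw_eq : ∀ n, polyLaplacian d (ballWeight d (ρ n) ^ 2 * g) =
      polyLaplacian d (w ^ 2 * g) - (2 * τ n) • polyLaplacian d (w * g) +
        (τ n ^ 2) • polyLaplacian d g := by
    intro n
    have : ballWeight d (ρ n) = w - C (τ n) := by simp [hw, ballWeight, hτ]
    rw [← map_smul, ← map_smul, ← map_sub, ← map_add, this]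
    congr 1
    simp only [smul_eq_C_mul, map_mul, map_pow]
    rw [show (C 2 : MvPolynomial (Fin d) ℂ) = 2 from map_ofNat C 2]
    ring
  have hzero : ∀ n, (∫ y in ball c (ρ n), f y * polyFun c (polyLaplacian d (w ^ 2 * g)) y) -
      (2 * τ n) * (∫ y in ball c (ρ n), f y * polyFun c (polyLaplacian d (w * g)) y) +
      τ n ^ 2 * (∫ y in ball c (ρ n), f y * polyFun c (polyLaplacian d g) y) = 0 := by
    intro n
    have hG := integral_ball_green isOpen_ball (closedBall_subset_ball (hρR n))
      hf.contDiffOn (c := c) g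
    have hr : ∫ y in ball c (ρ n), polyFun c (ballWeight d (ρ n) ^ 2 * g) y * Δ f y = 0 := by
      rw [setIntegral_congr_fun measurableSet_ball (g := fun _ => 0)]
      · simp
      · intro y hy
        have := (hf y (ball_subset_ball (hρR n).le hy)).2.self_of_nhds
        simp only [this, Pi.zero_apply, mul_zero]
    have hs : ball c (ρ n) ⊆ ball c R := ball_subset_ball (hρR n).le
    have hm := fun p => (hmulint p).mono_set hs
    rw [hr, hw_eq] at hG
    have hA : IntegrableOn (fun y => f y * polyFun c (polyLaplacian d (w ^ 2 * g)) y -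
        (2 * τ n) * (f y * polyFun c (polyLaplacian d (w * g)) y)) (ball c (ρ n)) :=
      (hm _).sub ((hm _).const_mul _)
    have hB : IntegrableOn (fun y => τ n ^ 2 * (f y * polyFun c (polyLaplacian d g) y))
      (ball c (ρ n)) := (hm _).const_mul _
    rw [← hG, ← integral_const_mul, ← integral_const_mul, ← integral_sub (hm _)
      ((hm _).const_mul _), ← integral_add hA hB]
    congr 1
    funext y
    simp only [polyFun_add, polyFun_sub, polyFun_smul]
    ring
  have hL := ((hlim (polyLaplacian d (w ^ 2 * g))).sub
    ((hτlim.const_mul 2).mul (hlim (polyLaplacian d (w * g))))).add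
    ((hτlim.pow 2).mul (hlim (polyLaplacian d g)))
  rw [tendsto_congr hzero] at hL
  have := tendsto_nhds_unique hL tendsto_const_nhds
  simpa using! this

theorem integral_polyFun_mul_polyConj (c : EuclideanSpace ℝ (Fin d))
    (s : Set (EuclideanSpace ℝ (Fin d))) (p : MvPolynomial (Fin d) ℂ) :
    ∫ y in s, polyFun c (p * polyConj p) y = ((∫ y in s, ‖polyFun c p y‖ ^ 2 : ℝ) : ℂ) := by
  rw [← integral_complex_ofReal]
  congr 1
  funext y
  rw [polyFun_mul, polyFun_polyConj, Complex.mul_conj, Complex.normSq_eq_norm_sq]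

theorem eq_zero_of_integral_ball_norm_sq_eq_zero {c : EuclideanSpace ℝ (Fin d)} {R : ℝ} (hR : 0 < R)
    {p : MvPolynomial (Fin d) ℂ} (h : ∫ y in ball c R, ‖polyFun c p y‖ ^ 2 = 0) :
    p = 0 := by
  refine eq_zero_of_polyFun_eqOn_ball (c := c) hR ?_
  have hcont : Continuous fun y => ‖polyFun c p y‖ ^ 2 := (continuous_polyFun c p).norm.pow 2
  have hi : IntegrableOn (fun y => ‖polyFun c p y‖ ^ 2) (ball c R) :=
    (hcont.continuousOn.integrableOn_compact
      (isCompact_closedBall c R)).mono_set ball_subset_closedBall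
  rw [setIntegral_eq_zero_iff_of_nonneg_ae (Eventually.of_forall fun y => by positivity) hi] at h
  have h2 := Measure.eqOn_open_of_ae_eq h isOpen_ball hcont.continuousOn continuousOn_const
  intro y hy
  simpa using h2 hy

theorem totalDegree_pderiv_le {σ R : Type*} [CommSemiring R] (i : σ) (p : MvPolynomial σ R) :
    (pderiv i p).totalDegree ≤ p.totalDegree - 1 := by
  classical
  conv_lhs => rw [p.as_sum, map_sum]
  refine (totalDegree_finsetSum _ _).trans (Finset.sup_le fun m hm => ?_)
  rw [pderiv_monomial]
  by_cases hmi : m i = 0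
  · simp [hmi]
  refine (totalDegree_monomial_le _ _).trans ?_
  change ((m - Finsupp.single i 1).sum fun _ e => e) ≤ _
  have h1 := le_totalDegree hm
  have h2 : m = (m - Finsupp.single i 1) + Finsupp.single i 1 := by
    rw [tsub_add_cancel_of_le]
    rw [Finsupp.single_le_iff]; omega
  have h3 : (m.sum fun _ e => e) = ((m - Finsupp.single i 1).sum fun _ e => e) + 1 := by
    conv_lhs => rw [h2]
    rw [Finsupp.sum_add_index' (fun _ => rfl) (fun _ _ _ => rfl)]
    simp
  omega

theorem totalDegree_polyLaplacian_le (p : MvPolynomial (Fin d) ℂ) :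
    (polyLaplacian d p).totalDegree ≤ p.totalDegree - 2 := by
  rw [polyLaplacian_apply]
  refine totalDegree_finsetSum_le fun i _ => ?_
  have h1 := totalDegree_pderiv_le i p
  have h2 := totalDegree_pderiv_le i (pderiv i p)
  omega

theorem totalDegree_ballWeight_le (ρ : ℝ) : (ballWeight d ρ).totalDegree ≤ 2 := by
  refine (totalDegree_sub _ _).trans (max_le ((totalDegree_C _).le.trans zero_le_two) ?_)
  exact totalDegree_finsetSum_le fun i _ => (totalDegree_pow _ _).trans (by simp)

theorem polyConj_mul (p q : MvPolynomial (Fin d) ℂ) :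
    polyConj (p * q) = polyConj p * polyConj q := map_mul _ _ _

theorem ballWeight_ne_zero {ρ : ℝ} (hρ : 0 < ρ) : ballWeight d ρ ≠ 0 := by
  intro h
  have := polyFun_ballWeight (0 : EuclideanSpace ℝ (Fin d)) ρ 0
  rw [h, polyFun_zero, eq_comm, Complex.ofReal_eq_zero] at this
  simp [hρ.ne'] at this

theorem integral_ball_polyGreen (c : EuclideanSpace ℝ (Fin d)) (R : ℝ)
    (p g : MvPolynomial (Fin d) ℂ) :
    ∫ y in ball c R, polyFun c (p * polyLaplacian d (ballWeight d R ^ 2 * g)) y =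
      ∫ y in ball c R, polyFun c (ballWeight d R ^ 2 * g * polyLaplacian d p) y := by
  have := integral_ball_green isOpen_univ (Set.subset_univ (closedBall c R))
    (contDiff_polyFun c p).contDiffOn g
  rw [laplacian_polyFun] at this
  simpa using this

/-- The bilaplacian is injective on polynomials with zero Dirichlet data: `∫ |Δu|² = 0` gives
`Δu = 0`, and then `∫ |∇u|² = 0`. -/
theorem eq_zero_of_polyLaplacian_polyLaplacian_eq_zero (hd : 1 ≤ d) {R : ℝ} (hR : 0 < R)
    {g : MvPolynomial (Fin d) ℂ}
    (h : polyLaplacian d (polyLaplacian d (ballWeight d R ^ 2 * g)) = 0) : g = 0 := by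
  set w := ballWeight d R with hw
  set u := w ^ 2 * g with hu
  have hconj : polyConj u = w ^ 2 * polyConj g := by
    rw [hu, pow_two, polyConj_mul, polyConj_mul, hw, ballWeight_conj]
  have h1 : polyLaplacian d u = 0 := by
    refine eq_zero_of_integral_ball_norm_sq_eq_zero (c := 0) hR ?_
    rw [← Complex.ofReal_eq_zero, ← integral_polyFun_mul_polyConj, ← polyLaplacian_polyConj, hconj,
      integral_ball_polyGreen, h]
    simp
  -- `|∇u|²` is the divergence of `ū ∇u`, because `Δu = 0`
  have h2 : ∀ i, pderiv i u = 0 := by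
    have hsum : ∑ i, ∫ y in ball 0 R, ‖polyFun 0 (pderiv i u) y‖ ^ 2 = 0 := by
      rw [← Complex.ofReal_eq_zero, Complex.ofReal_sum]
      simp_rw [← integral_polyFun_mul_polyConj]
      rw [← integral_finsetSum _ fun i _ => integrableOn_ball_polyFun 0 R _]
      have hdiv : ∑ i, pderiv i u * polyConj (pderiv i u) =
          ∑ i, pderiv i (w * (w * polyConj g * pderiv i u)) := by
        have : ∀ i, pderiv i (w * (w * polyConj g * pderiv i u)) =
            pderiv i u * polyConj (pderiv i u) + polyConj u * pderiv i (pderiv i u) := by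
          intro i
          rw [← pderiv_polyConj, show w * (w * polyConj g * pderiv i u) =
            polyConj u * pderiv i u by rw [hconj]; ring]
          simp only [Derivation.leibniz, smul_eq_mul]
          ring
        simp_rw [this]
        rw [Finset.sum_add_distrib, ← Finset.mul_sum, ← polyLaplacian_apply, h1, mul_zero, add_zero]
      simp_rw [← polyFun_sum, hdiv, polyFun_sum]
      rw [integral_finsetSum _ fun i _ => integrableOn_ball_polyFun 0 R _]
      exact Finset.sum_eq_zero fun i _ => integral_ball_pderiv_ballWeight_mul 0 R _ i
    rw [Finset.sum_eq_zero_iff_of_nonneg fun i _ => integral_nonneg fun y => by positivity] at hsum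
    exact fun i => eq_zero_of_integral_ball_norm_sq_eq_zero hR (hsum i (Finset.mem_univ i))
  have hfd : ∀ y, fderiv ℝ (polyFun 0 u) y = 0 := by
    intro y
    refine ContinuousLinearMap.coe_injective
      ((EuclideanSpace.basisFun (Fin d) ℝ).toBasis.ext fun i => ?_)
    simp [fderiv_polyFun_single, h2]
  have hconst := is_const_of_fderiv_eq_zero (differentiable_polyFun 0 u) hfd
  have hbd : polyFun 0 u (EuclideanSpace.single ⟨0, hd⟩ R) = 0 := by
    rw [hu, polyFun_mul, pow_two, polyFun_mul, hw, polyFun_ballWeight]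
    simp
  have hu0 : u = 0 := eq_zero_of_polyFun_eqOn_ball (c := 0) one_pos fun y _ => by
    rw [hconst y (EuclideanSpace.single ⟨0, hd⟩ R), hbd]
  exact (mul_eq_zero.1 hu0).resolve_left (pow_ne_zero 2 (ballWeight_ne_zero hR))

/-- Every polynomial is the sum of a harmonic polynomial and the Laplacian of a polynomial
vanishing to second order on a given sphere. -/
theorem exists_harmonic_add_polyLaplacian (hd : 1 ≤ d) {R : ℝ} (hR : 0 < R)
    (q : MvPolynomial (Fin d) ℂ) :
    ∃ h g, polyLaplacian d h = 0 ∧ q = h + polyLaplacian d (ballWeight d R ^ 2 * g) := by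
  obtain ⟨m, hm⟩ : ∃ m, q.totalDegree ≤ m := ⟨_, le_rfl⟩
  set A : MvPolynomial (Fin d) ℂ →ₗ[ℂ] MvPolynomial (Fin d) ℂ :=
    polyLaplacian d ∘ₗ polyLaplacian d ∘ₗ LinearMap.mulLeft ℂ (ballWeight d R ^ 2) with hA
  have hAm : ∀ g ∈ restrictTotalDegree (Fin d) ℂ m, A g ∈ restrictTotalDegree (Fin d) ℂ m := by
    intro g hg
    rw [mem_restrictTotalDegree] at hg ⊢
    have h0 := totalDegree_polyLaplacian_le (polyLaplacian d (ballWeight d R ^ 2 * g))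
    have h1 := totalDegree_polyLaplacian_le (ballWeight d R ^ 2 * g)
    have h2 := totalDegree_mul (ballWeight d R ^ 2) g
    have h3 := totalDegree_pow (ballWeight d R) 2
    have h4 := totalDegree_ballWeight_le (d := d) R
    simp only [hA, LinearMap.comp_apply, LinearMap.mulLeft_apply]
    omega
  set T := A.restrict hAm
  have hT : ∀ g, (T g : MvPolynomial (Fin d) ℂ) =
      polyLaplacian d (polyLaplacian d (ballWeight d R ^ 2 * g)) := fun g => rfl
  have hTinj : Function.Injective T := by
    rw [← LinearMap.ker_eq_bot, LinearMap.ker_eq_bot']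
    rintro ⟨g, hg⟩ h0
    refine Subtype.ext (eq_zero_of_polyLaplacian_polyLaplacian_eq_zero hd hR ?_)
    rw [← hT ⟨g, hg⟩, h0]
    rfl
  have hq : polyLaplacian d q ∈ restrictTotalDegree (Fin d) ℂ m := by
    rw [mem_restrictTotalDegree]
    exact (totalDegree_polyLaplacian_le q).trans ((Nat.sub_le _ _).trans hm)
  obtain ⟨⟨g, hg⟩, hgq⟩ := LinearMap.injective_iff_surjective.1 hTinj ⟨_, hq⟩
  refine ⟨q - polyLaplacian d (ballWeight d R ^ 2 * g), g, ?_, by ring⟩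
  rw [map_sub, sub_eq_zero]
  rw [← hT ⟨g, hg⟩, hgq]

/-- Homogeneous harmonic polynomials of different degrees are orthogonal on balls: for harmonic
`p` and `q`, by Euler's identity, `∑ ∂ᵢ (w (q ∂ᵢp - p ∂ᵢq)) = -2 (k - l) p q`. -/
theorem integral_ball_mul_eq_zero_of_isHomogeneous {k l : ℕ} (hkl : k ≠ l)
    {p q : MvPolynomial (Fin d) ℂ} (hp : polyLaplacian d p = 0) (hq : polyLaplacian d q = 0)
    (hpk : p.IsHomogeneous k) (hql : q.IsHomogeneous l) (c : EuclideanSpace ℝ (Fin d)) (R : ℝ) :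
    ∫ y in ball c R, polyFun c (p * q) y = 0 := by
  have hkl' : (-2 * ((k : ℂ) - l)) ≠ 0 := by
    simp [sub_eq_zero, hkl]
  have hdiv : ∑ i, pderiv i (ballWeight d R * (q * pderiv i p - p * pderiv i q)) =
      (-2 * ((k : ℂ) - l)) • (p * q) := by
    have : ∀ i, pderiv i (ballWeight d R * (q * pderiv i p - p * pderiv i q)) =
        -2 * (q * (X i * pderiv i p) - p * (X i * pderiv i q)) +
          ballWeight d R * (q * pderiv i (pderiv i p) - p * pderiv i (pderiv i q)) := by
      intro i
      simp only [Derivation.leibniz, smul_eq_mul, map_sub, pderiv_ballWeight]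
      ring
    simp_rw [this]
    rw [Finset.sum_add_distrib, ← Finset.mul_sum, ← Finset.mul_sum, Finset.sum_sub_distrib,
      Finset.sum_sub_distrib, ← Finset.mul_sum, ← Finset.mul_sum, ← Finset.mul_sum,
      ← Finset.mul_sum, hpk.sum_X_mul_pderiv, hql.sum_X_mul_pderiv, ← polyLaplacian_apply,
      ← polyLaplacian_apply, hp, hq]
    simp only [nsmul_eq_mul, smul_eq_C_mul, map_mul, map_neg, map_sub, map_natCast, map_ofNat]
    ring
  have h0 : ∫ y in ball c R, polyFun c ((-2 * ((k : ℂ) - l)) • (p * q)) y = 0 := by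
    rw [← hdiv]
    simp_rw [polyFun_sum]
    rw [integral_finsetSum _ fun i _ => integrableOn_ball_polyFun c R _]
    exact Finset.sum_eq_zero fun i _ => integral_ball_pderiv_ballWeight_mul c R _ i
  simp_rw [polyFun_smul] at h0
  rw [integral_const_mul] at h0
  exact (mul_eq_zero.1 h0).resolve_left hkl'

end Green

/-! ### Density of polynomials -/

section Density

open Metric Filter Topology MvPolynomial Laplacian

variable {d : ℕ}

/-- Stone-Weierstrass for polynomials in `y - c`. -/
theorem exists_polyFun_near (c : EuclideanSpace ℝ (Fin d)) {K : Set (EuclideanSpace ℝ (Fin d))}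
    (hK : IsCompact K) {f : EuclideanSpace ℝ (Fin d) → ℝ} (hf : Continuous f) {ε : ℝ}
    (hε : 0 < ε) : ∃ p : MvPolynomial (Fin d) ℂ, ∀ y ∈ K, ‖polyFun c p y - f y‖ < ε := by
  let X' : Fin d → C(EuclideanSpace ℝ (Fin d), ℝ) := fun i => ⟨fun y => y i - c i, by fun_prop⟩
  let Φ : MvPolynomial (Fin d) ℝ →ₐ[ℝ] C(EuclideanSpace ℝ (Fin d), ℝ) := aeval X'
  have hsep : Φ.range.SeparatesPoints := by
    intro y z hyz
    obtain ⟨i, hi⟩ : ∃ i, y i ≠ z i := by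
      by_contra! h
      exact hyz (PiLp.ext h)
    refine ⟨X' i, ⟨X' i, ⟨X i, by simp [Φ]⟩, rfl⟩, ?_⟩
    simpa [X'] using hi
  obtain ⟨g, ⟨p, rfl⟩, hp⟩ :=
    ContinuousMap.exists_mem_subalgebra_near_continuous_of_isCompact_of_separatesPoints
      hsep ⟨f, hf⟩ hK hε
  refine ⟨map Complex.ofRealHom p, fun y hy => ?_⟩
  have h : polyFun c (map Complex.ofRealHom p) y = ((Φ p y : ℝ) : ℂ) := by
    clear hp
    induction p using MvPolynomial.induction_on with
    | C a => simp [Φ]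
    | add p q hp hq => simp [hp, hq]
    | mul_X p i hp => simp [hp, Φ, X']
  rw [h, ← Complex.ofReal_sub, Complex.norm_real]
  exact hp y hy

/-- An integrable harmonic function on a ball orthogonal to all harmonic polynomials vanishes: it is also
orthogonal to the Laplacians of polynomials vanishing to second order on the sphere, hence to all
polynomials. -/
theorem ae_eq_zero_of_forall_integral_harmonic_eq_zero (hd : 1 ≤ d)
    {c : EuclideanSpace ℝ (Fin d)} {R : ℝ}
    (hR : 0 < R) {f : EuclideanSpace ℝ (Fin d) → ℂ} (hf : HarmonicOnNhd f (ball c R))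
    (hfi : IntegrableOn f (ball c R))
    (h : ∀ p, polyLaplacian d p = 0 → ∫ y in ball c R, f y * polyFun c p y = 0) :
    f =ᵐ[volume.restrict (ball c R)] 0 := by
  have hmulint : ∀ p, IntegrableOn (fun y => f y * polyFun c p y) (ball c R) := by
    intro p
    obtain ⟨M, hM⟩ := (isCompact_closedBall c R).exists_bound_of_continuousOn
      (continuous_polyFun c p).continuousOn
    refine Integrable.mul_bdd (c := M) hfi (continuous_polyFun c p).aestronglyMeasurable ?_
    exact (ae_restrict_mem measurableSet_ball).mono fun y hy => hM y (ball_subset_closedBall hy)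
  have hall : ∀ q, ∫ y in ball c R, f y * polyFun c q y = 0 := by
    intro q
    obtain ⟨p, g, hp, rfl⟩ := exists_harmonic_add_polyLaplacian hd hR q
    simp_rw [polyFun_add, mul_add]
    rw [integral_add (hmulint _) (hmulint _), h p hp,
      integral_ball_mul_polyLaplacian_eq_zero hf hfi g, add_zero]
  have hae := isOpen_ball.ae_eq_zero_of_integral_contDiff_smul_eq_zero (μ := volume)
    (f := f) (U := ball c R) hfi.locallyIntegrableOn ?_
  · rw [EventuallyEq, ae_restrict_iff' measurableSet_ball]
    exact hae
  intro g hg _ hgU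
  have hgint : IntegrableOn (fun y => g y • f y) (ball c R) := by
    obtain ⟨M, hM⟩ := (isCompact_closedBall c R).exists_bound_of_continuousOn
      hg.continuous.continuousOn
    refine Integrable.bdd_smul hfi hg.continuous.aestronglyMeasurable (C := M) ?_
    exact (ae_restrict_mem measurableSet_ball).mono fun y hy => hM y (ball_subset_closedBall hy)
  have hset : ∫ y, g y • f y = ∫ y in ball c R, g y • f y := by
    refine (setIntegral_eq_integral_of_forall_compl_eq_zero fun y hy => ?_).symm
    rw [image_eq_zero_of_notMem_tsupport fun h => hy (hgU h), zero_smul]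
  rw [hset]
  have hbound : ∀ ε > 0, ‖∫ y in ball c R, g y • f y‖ ≤ ε * ∫ y in ball c R, ‖f y‖ := by
    intro ε hε
    obtain ⟨p, hp⟩ := exists_polyFun_near c (isCompact_closedBall c R) hg.continuous hε
    have : ∫ y in ball c R, g y • f y = ∫ y in ball c R, (g y • f y - f y * polyFun c p y) := by
      rw [integral_sub hgint (hmulint p), hall p, sub_zero]
    rw [this, ← integral_const_mul]
    refine norm_integral_le_of_norm_le (hfi.norm.const_mul ε) ?_
    refine (ae_restrict_mem measurableSet_ball).mono fun y hy => ?_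
    have := (hp y (ball_subset_closedBall hy)).le
    rw [Complex.real_smul, mul_comm (f y), ← sub_mul, norm_mul, norm_sub_rev]
    gcongr
  have hlim : Tendsto (fun ε : ℝ => ε * ∫ y in ball c R, ‖f y‖) (𝓝[>] 0) (𝓝 0) := by
    have : Tendsto (fun ε : ℝ => ε * ∫ y in ball c R, ‖f y‖) (𝓝 0) (𝓝 (0 * _)) :=
      tendsto_id.mul_const _
    rw [zero_mul] at this
    exact this.mono_left nhdsWithin_le_nhds
  have := ge_of_tendsto hlim (eventually_mem_nhdsWithin.mono fun ε hε => hbound ε hε)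
  exact norm_le_zero_iff.1 this

end Density

/-! ### A mean value property -/

section MeanValue

open Metric Filter Topology MvPolynomial Laplacian

variable {d : ℕ}

theorem fderiv_apply_eq_sum {G : Type*} [NormedAddCommGroup G] [NormedSpace ℝ G]
    (L : EuclideanSpace ℝ (Fin d) →L[ℝ] G) (v : EuclideanSpace ℝ (Fin d)) :
    L v = ∑ i, v i • L (EuclideanSpace.single i 1) := by
  conv_lhs => rw [← (EuclideanSpace.basisFun (Fin d) ℝ).sum_repr v]
  simp

/-- The radial derivative of a harmonic function has weighted mean zero over balls, since
`w⁴ y` is a gradient of a function vanishing on the sphere. -/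
theorem integral_ball_weight_mul_fderiv_eq_zero {U : Set (EuclideanSpace ℝ (Fin d))}
    (hU : IsOpen U) {f : EuclideanSpace ℝ (Fin d) → ℂ} (hf : HarmonicOnNhd f U)
    {x : EuclideanSpace ℝ (Fin d)} {δ t : ℝ}
    (hsub : ∀ y ∈ closedBall (0 : EuclideanSpace ℝ (Fin d)) δ, x + t • y ∈ U) :
    ∫ y in ball 0 δ, polyFun 0 (ballWeight d δ ^ 4) y * fderiv ℝ f (x + t • y) y = 0 := by
  set w := ballWeight d δ with hw
  set e : Fin d → EuclideanSpace ℝ (Fin d) := fun i => EuclideanSpace.single i 1 with he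
  set A : EuclideanSpace ℝ (Fin d) → EuclideanSpace ℝ (Fin d) := fun y => x + t • y with hA
  have hAc : ContDiff ℝ 2 A := by fun_prop
  set V := A ⁻¹' U with hV
  have hVo : IsOpen V := hU.preimage hAc.continuous
  have hVsub : closedBall 0 δ ⊆ V := hsub
  have hballV : ball 0 δ ⊆ V := ball_subset_closedBall.trans hVsub
  have hf1 : ∀ i, ContDiffOn ℝ 1 (fun z => fderiv ℝ f z (e i)) U := fun i =>
    (hf.contDiffOn.fderiv_of_isOpen hU (by norm_num)).clm_apply contDiffOn_const
  have hg1 : ∀ i, ContDiffOn ℝ 1 (fun y => fderiv ℝ f (A y) (e i)) V := fun i =>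
    (hf1 i).comp (hAc.of_le (by norm_num)).contDiffOn fun y hy => hy
  have hf2c : ∀ i, ContinuousOn
      (fun y => fderiv ℝ (fun z => fderiv ℝ f z (e i)) (A y) (e i)) V := fun i =>
    (((hf1 i).continuousOn_fderiv_of_isOpen hU le_rfl).clm_apply continuousOn_const).comp
      hAc.continuous.continuousOn fun y hy => hy
  have hint : ∀ h : EuclideanSpace ℝ (Fin d) → ℂ, ContinuousOn h V →
      IntegrableOn h (ball 0 δ) :=
    fun h hh => (ContinuousOn.integrableOn_compact (isCompact_closedBall _ δ)
      (hh.mono hVsub)).mono_set ball_subset_closedBall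
  have key : ∀ i, ∫ y in ball 0 δ, ((-10 : ℂ) * (polyFun 0 (w ^ 4) y *
      (y i • fderiv ℝ f (A y) (e i))) +
      (t : ℂ) * (polyFun 0 (w ^ 5) y * fderiv ℝ (fun z => fderiv ℝ f z (e i)) (A y) (e i))) = 0 := by
    intro i
    have hF : ContDiffOn ℝ 1 (fun y => polyFun 0 (w ^ 4) y * fderiv ℝ f (A y) (e i)) V :=
      (contDiff_polyFun 0 _).contDiffOn.mul (hg1 i)
    rw [← integral_ball_fderiv_weight_smul_eq_zero volume hVo hVsub hF (e i)]
    refine setIntegral_congr_fun measurableSet_ball fun y hy => ?_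
    have hyV := hballV hy
    have hfun : (fun z => (δ ^ 2 - ‖z - 0‖ ^ 2) •
        (polyFun 0 (w ^ 4) z * fderiv ℝ f (A z) (e i))) =
        fun z => polyFun 0 (w ^ 5) z * fderiv ℝ f (A z) (e i) := by
      funext z
      rw [show w ^ 5 = w * w ^ 4 by ring, polyFun_mul 0 w, hw, polyFun_ballWeight,
        Complex.real_smul, mul_assoc]
    rw [hfun]
    have hA' : HasFDerivAt A (t • ContinuousLinearMap.id ℝ _) y :=
      ((hasFDerivAt_id y).const_smul t).const_add x
    have hd1 : HasFDerivAt (fun z => fderiv ℝ f z (e i))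
        (fderiv ℝ (fun z => fderiv ℝ f z (e i)) (A y)) (A y) :=
      (((hf1 i).differentiableOn one_ne_zero).differentiableAt (hU.mem_nhds hyV)).hasFDerivAt
    have hd := (differentiable_polyFun 0 (w ^ 5) y).hasFDerivAt.fun_mul (hd1.comp y hA')
    have hp : pderiv i (w ^ 5) = -10 * (w ^ 4 * X i) := by
      rw [Derivation.leibniz_pow, hw, pderiv_ballWeight]
      simp only [smul_eq_mul, nsmul_eq_mul]
      push_cast
      ring
    have hp10 : polyFun 0 (pderiv i (w ^ 5)) y = -10 * (polyFun 0 (w ^ 4) y * (y i : ℂ)) := by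
      rw [hp, show (-10 : MvPolynomial (Fin d) ℂ) = C (-10) by simp [map_ofNat], polyFun_mul,
        polyFun_mul, polyFun_C, polyFun_X]
      simp
    simp only [Function.comp_def] at hd
    rw [hd.fderiv]
    simp only [add_apply, smul_apply, smul_eq_mul, ContinuousLinearMap.comp_apply,
      ContinuousLinearMap.id_apply, map_smul, he, fderiv_polyFun_single, hp10, Complex.real_smul]
    ring
  have hi1 : ∀ i, IntegrableOn (fun y => (-10 : ℂ) * (polyFun 0 (w ^ 4) y *
      (y i • fderiv ℝ f (A y) (e i)))) (ball 0 δ) := fun i => by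
    refine hint _ (continuousOn_const.mul ((continuous_polyFun 0 _).continuousOn.mul ?_))
    refine ContinuousOn.fun_smul (Continuous.continuousOn ?_) (hg1 i).continuousOn
    fun_prop
  have hi2 : ∀ i, IntegrableOn (fun y => (t : ℂ) * (polyFun 0 (w ^ 5) y *
      fderiv ℝ (fun z => fderiv ℝ f z (e i)) (A y) (e i))) (ball 0 δ) := fun i =>
    hint _ (continuousOn_const.mul ((continuous_polyFun 0 _).continuousOn.mul (hf2c i)))
  have hsum := Finset.sum_eq_zero (s := Finset.univ) fun i _ => key i
  have hi3 : ∀ i, IntegrableOn (fun y => (-10 : ℂ) * (polyFun 0 (w ^ 4) y *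
      (y i • fderiv ℝ f (A y) (e i))) + (t : ℂ) * (polyFun 0 (w ^ 5) y *
      fderiv ℝ (fun z => fderiv ℝ f z (e i)) (A y) (e i))) (ball 0 δ) :=
    fun i => (hi1 i).add (hi2 i)
  rw [← integral_finsetSum _ fun i _ => hi3 i] at hsum
  have hfin : ∫ y in ball 0 δ, (-10 : ℂ) * (polyFun 0 (w ^ 4) y * fderiv ℝ f (A y) y) = 0 := by
    rw [← hsum]
    refine setIntegral_congr_fun measurableSet_ball fun y hy => ?_
    have hyV : A y ∈ U := hballV hy
    have h0 : ∑ i, fderiv ℝ (fun z => fderiv ℝ f z (e i)) (A y) (e i) = 0 := by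
      rw [← laplacian_eq_sum_fderiv_fderiv (hf _ hyV).1]
      exact (hf _ hyV).2.self_of_nhds
    simp only [Finset.sum_add_distrib, ← Finset.mul_sum, h0, mul_zero, add_zero]
    rw [fderiv_apply_eq_sum (fderiv ℝ f (A y)) y]
  rw [integral_const_mul] at hfin
  exact (mul_eq_zero.1 hfin).resolve_left (by norm_num)

/-- Mean value property for a radial weight: the weighted mean of `y ↦ f (x + t y)` over a ball
does not depend on `t`. -/
theorem integral_ball_weight_mul_harmonic {U : Set (EuclideanSpace ℝ (Fin d))}
    (hU : IsOpen U) {f : EuclideanSpace ℝ (Fin d) → ℂ} (hf : HarmonicOnNhd f U)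
    {x : EuclideanSpace ℝ (Fin d)} {δ : ℝ} (hsub : closedBall x (2 * δ) ⊆ U) :
    ∫ y in ball 0 δ, polyFun 0 (ballWeight d δ ^ 4) y * f (x + y) =
      (∫ y in ball 0 δ, polyFun 0 (ballWeight d δ ^ 4) y) * f x := by
  set W := polyFun 0 (ballWeight d δ ^ 4) with hW
  have hWc : Continuous W := continuous_polyFun _ _
  have hmem : ∀ t : ℝ, |t| ≤ 2 → ∀ y ∈ closedBall (0 : EuclideanSpace ℝ (Fin d)) δ,
      x + t • y ∈ closedBall x (2 * δ) := by
    intro t ht y hy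
    rw [mem_closedBall_zero_iff] at hy
    rw [mem_closedBall, dist_eq_norm, add_sub_cancel_left, norm_smul]
    exact mul_le_mul ht hy (norm_nonneg _) zero_le_two
  have hfc : ContinuousOn f U := hf.continuousOn
  have hf'c : ContinuousOn (fderiv ℝ f) U :=
    hf.contDiffOn.continuousOn_fderiv_of_isOpen hU (by norm_num)
  obtain ⟨M, hM⟩ := (isCompact_closedBall x (2 * δ)).exists_bound_of_continuousOn (hf'c.mono hsub)
  obtain ⟨N, hN⟩ := (isCompact_closedBall (0 : EuclideanSpace ℝ (Fin d)) δ).exists_bound_of_continuousOn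
    hWc.continuousOn
  have hcont : ∀ t : ℝ, |t| ≤ 2 → ContinuousOn (fun y => W y * f (x + t • y)) (closedBall 0 δ) :=
    fun t ht => hWc.continuousOn.mul (hfc.comp (by fun_prop) fun y hy => hsub (hmem t ht y hy))
  have hcont' : ∀ t : ℝ, |t| ≤ 2 →
      ContinuousOn (fun y => W y * fderiv ℝ f (x + t • y) y) (closedBall 0 δ) :=
    fun t ht => hWc.continuousOn.mul
      ((hf'c.comp (by fun_prop) fun y hy => hsub (hmem t ht y hy)).clm_apply continuousOn_id)
  have hderiv : ∀ t ∈ Set.Icc (0 : ℝ) 1,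
      HasDerivAt (fun t : ℝ => ∫ y in ball 0 δ, W y * f (x + t • y)) 0 t := by
    intro t ht
    have ht2 : ∀ s ∈ ball t 1, |s| ≤ 2 := by
      intro s hs
      rw [mem_ball, Real.dist_eq, abs_lt] at hs
      rw [abs_le]
      constructor <;> linarith [ht.1, ht.2]
    have h := hasDerivAt_integral_of_dominated_loc_of_deriv_le
      (μ := volume.restrict (ball (0 : EuclideanSpace ℝ (Fin d)) δ))
      (F := fun (t : ℝ) y => W y * f (x + t • y))
      (F' := fun (t : ℝ) y => W y * fderiv ℝ f (x + t • y) y) (x₀ := t) (s := ball t 1)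
      (bound := fun _ => N * (M * δ)) (ball_mem_nhds t one_pos) ?_ ?_ ?_ ?_ ?_ ?_
    · have h0 := integral_ball_weight_mul_fderiv_eq_zero hU hf (x := x) (δ := δ) (t := t)
        fun y hy => hsub (hmem t (ht2 t (mem_ball_self one_pos)) y hy)
      have h2 := h.2
      rw [h0] at h2
      exact h2
    · filter_upwards [ball_mem_nhds t one_pos] with s hs
      exact ((hcont s (ht2 s hs)).mono ball_subset_closedBall).aestronglyMeasurable
        measurableSet_ball
    · exact ((hcont t (ht2 t (mem_ball_self one_pos))).integrableOn_compact
        (isCompact_closedBall _ _)).mono_set ball_subset_closedBall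
    · exact ((hcont' t (ht2 t (mem_ball_self one_pos))).mono
        ball_subset_closedBall).aestronglyMeasurable measurableSet_ball
    · refine (ae_restrict_mem measurableSet_ball).mono fun y hy s hs => ?_
      have hy' := ball_subset_closedBall hy
      have h1 := hN y hy'
      have h2 := hM _ (hmem s (ht2 s hs) y hy')
      have h3 : ‖y‖ ≤ δ := mem_closedBall_zero_iff.1 hy'
      rw [norm_mul]
      refine mul_le_mul h1 ?_ (norm_nonneg _) ((norm_nonneg _).trans h1)
      exact (ContinuousLinearMap.le_opNorm _ _).trans
        (mul_le_mul h2 h3 (norm_nonneg _) ((norm_nonneg _).trans h2))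
    · exact integrableOn_const (measure_ball_lt_top.ne)
    · refine (ae_restrict_mem measurableSet_ball).mono fun y hy s hs => ?_
      have hy' := hsub (hmem s (ht2 s hs) y (ball_subset_closedBall hy))
      have hfd : HasFDerivAt f (fderiv ℝ f (x + s • y)) (x + s • y) :=
        ((hf _ hy').1.differentiableAt two_ne_zero).hasFDerivAt
      have hl : HasDerivAt (fun s : ℝ => x + s • y) y s := by
        simpa using! ((hasDerivAt_id s).smul_const y).const_add x
      exact (hfd.comp_hasDerivAt s hl).const_mul (W y)
  have hconst := constant_of_has_deriv_right_zero
    (f := fun t : ℝ => ∫ y in ball 0 δ, W y * f (x + t • y))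
    (fun t ht => (hderiv t ht).continuousAt.continuousWithinAt)
    (fun t ht => (hderiv t (Set.Ico_subset_Icc_self ht)).hasDerivWithinAt) 1
    (Set.right_mem_Icc.2 zero_le_one)
  simp only [one_smul, zero_smul, add_zero] at hconst
  rw [hconst, integral_mul_const]

end MeanValue

/-! ### Completeness of the harmonic Bergman spaces -/

section Completeness

open Metric Filter Topology MvPolynomial Laplacian

theorem contDiff_max_zero_pow (n : ℕ) : ContDiff ℝ n (fun t : ℝ => (max t 0) ^ (n + 1)) := by
  induction n with
  | zero => exact contDiff_zero.2 (by fun_prop)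
  | succ n ih =>
    have hd : ∀ t : ℝ, HasDerivAt (fun t : ℝ => (max t 0) ^ (n + 1 + 1))
        (((n : ℝ) + 2) * (max t 0) ^ (n + 1)) t := by
      intro t
      have h := hasDerivAt_max_zero_rpow (a := ((n + 1 : ℕ) : ℝ)) (by positivity) t
      simp only [Real.rpow_natCast, show (1 : ℝ) + ((n + 1 : ℕ) : ℝ) = ((n + 1 + 1 : ℕ) : ℝ) by
        push_cast; ring] at h
      refine h.congr_deriv ?_
      push_cast
      ring
    rw [show ((n + 1 : ℕ) : WithTop ℕ∞) = (n : WithTop ℕ∞) + 1 by norm_cast,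
      contDiff_succ_iff_deriv]
    refine ⟨fun t => (hd t).differentiableAt, by simp, ?_⟩
    rw [show deriv (fun t : ℝ => (max t 0) ^ (n + 1 + 1)) = _ from funext fun t => (hd t).deriv]
    exact contDiff_const.mul ih

variable {d : ℕ}

/-- A radial `C³` bump function supported in the closed ball of radius `δ`. -/
noncomputable def radialBump (d : ℕ) (δ : ℝ) (y : EuclideanSpace ℝ (Fin d)) : ℝ :=
  (max (δ ^ 2 - ‖y‖ ^ 2) 0) ^ 4

theorem contDiff_radialBump (δ : ℝ) : ContDiff ℝ 2 (radialBump d δ) := by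
  have h : ContDiff ℝ 3 (fun t : ℝ => (max t 0) ^ 4) := contDiff_max_zero_pow 3
  exact (h.of_le (by norm_num)).comp (contDiff_const.sub (contDiff_norm_sq ℝ))

theorem radialBump_eq_zero {δ : ℝ} (hδ : 0 ≤ δ) {y : EuclideanSpace ℝ (Fin d)}
    (hy : y ∉ ball 0 δ) : radialBump d δ y = 0 := by
  rw [mem_ball_zero_iff, not_lt] at hy
  have := pow_le_pow_left₀ hδ hy 2
  rw [radialBump, max_eq_right (by linarith)]
  norm_num

theorem radialBump_eq_polyFun {δ : ℝ} {y : EuclideanSpace ℝ (Fin d)} (hy : y ∈ ball 0 δ) :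
    (radialBump d δ y : ℂ) = polyFun 0 (ballWeight d δ ^ 4) y := by
  have hp : ballWeight d δ ^ 4 = ballWeight d δ * (ballWeight d δ * (ballWeight d δ *
    ballWeight d δ)) := by ring
  rw [mem_ball_zero_iff] at hy
  have := pow_lt_pow_left₀ hy (norm_nonneg _) two_ne_zero
  rw [radialBump, max_eq_left (by linarith), hp]
  simp only [polyFun_mul, polyFun_ballWeight, sub_zero]
  push_cast
  ring

theorem hasCompactSupport_radialBump {δ : ℝ} (hδ : 0 ≤ δ) :
    HasCompactSupport (radialBump d δ) :=
  HasCompactSupport.intro (isCompact_closedBall 0 δ) fun _y hy =>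
    radialBump_eq_zero hδ fun h => hy (ball_subset_closedBall h)

theorem radialBump_sub_comm (δ : ℝ) (x y : EuclideanSpace ℝ (Fin d)) :
    radialBump d δ (x - y) = radialBump d δ (y - x) := by
  rw [radialBump, radialBump, norm_sub_rev]

theorem integral_radialBump_pos {δ : ℝ} (hδ : 0 < δ) : 0 < ∫ y, radialBump d δ y := by
  refine (contDiff_radialBump δ).continuous.integral_pos_of_hasCompactSupport_nonneg_nonzero
    (hasCompactSupport_radialBump hδ.le) (fun _ => ?_) (x := 0) ?_
  · rw [radialBump]; positivity
  · have : (0 : ℝ) < δ ^ 2 := by positivity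
    rw [radialBump, norm_zero, max_eq_left (by linarith)]
    simp [hδ.ne']

theorem integral_radialBump_smul_harmonic {U : Set (EuclideanSpace ℝ (Fin d))}
    (hU : IsOpen U) {f : EuclideanSpace ℝ (Fin d) → ℂ} (hf : HarmonicOnNhd f U)
    {x : EuclideanSpace ℝ (Fin d)} {δ : ℝ} (hδ : 0 < δ) (hsub : closedBall x (2 * δ) ⊆ U) :
    ∫ y, radialBump d δ (y - x) • f y = ((∫ y, radialBump d δ y : ℝ) : ℂ) * f x := by
  have h1 : ∫ y, radialBump d δ (y - x) • f y = ∫ y, radialBump d δ y • f (x + y) := by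
    rw [← integral_add_left_eq_self _ x]
    simp
  have h2 : ∫ y, radialBump d δ y • f (x + y) =
      ∫ y in ball 0 δ, radialBump d δ y • f (x + y) :=
    (setIntegral_eq_integral_of_forall_compl_eq_zero fun y hy => by
      rw [radialBump_eq_zero hδ.le hy, zero_smul]).symm
  have h3 : ∫ y, ((radialBump d δ y : ℝ) : ℂ) =
      ∫ y in ball 0 δ, ((radialBump d δ y : ℝ) : ℂ) :=
    (setIntegral_eq_integral_of_forall_compl_eq_zero fun y hy => by
      rw [radialBump_eq_zero hδ.le hy, Complex.ofReal_zero]).symm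
  rw [h1, h2, ← integral_complex_ofReal, h3,
    setIntegral_congr_fun measurableSet_ball fun y hy => radialBump_eq_polyFun hy,
    ← integral_ball_weight_mul_harmonic hU hf hsub]
  refine setIntegral_congr_fun measurableSet_ball fun y hy => ?_
  simp only [Complex.real_smul, radialBump_eq_polyFun hy]

theorem continuous_integral_mul_Lp {α : Type*} [MeasurableSpace α] {μ : Measure α} {ψ : α → ℂ}
    (hψ : MemLp ψ 2 μ) : Continuous fun f : Lp ℂ 2 μ => ∫ y, ψ y * f y ∂μ := by
  have h : (fun f : Lp ℂ 2 μ => ∫ y, ψ y * f y ∂μ) = fun f => ⟪hψ.star.toLp, f⟫_ℂ := by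
    funext f
    rw [L2.inner_def]
    refine integral_congr_ae ?_
    filter_upwards [hψ.star.coeFn_toLp] with y hy
    rw [hy]
    simp [mul_comm]
  rw [h]
  fun_prop

/-- A continuous function whose weighted means over small balls about a point vanish, vanishes at
that point. -/
theorem eq_zero_of_integral_ball_weight_eq_zero {h : EuclideanSpace ℝ (Fin d) → ℂ}
    {x : EuclideanSpace ℝ (Fin d)} {U : Set (EuclideanSpace ℝ (Fin d))} (hU : IsOpen U)
    (hx : x ∈ U) (hc : ContinuousOn h U)
    (hz : ∀ ρ > 0, closedBall x ρ ⊆ U →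
      ∫ y in ball x ρ, polyFun x (ballWeight d ρ ^ 2) y * h y = 0) : h x = 0 := by
  rw [← norm_le_zero_iff]
  refine le_of_forall_pos_le_add fun ε hε => ?_
  rw [zero_add]
  obtain ⟨r, hr, hrU⟩ := Metric.isOpen_iff.1 hU x hx
  obtain ⟨s, hs, hsε⟩ := Metric.continuousAt_iff.1 (hc.continuousAt (hU.mem_nhds hx)) ε hε
  obtain ⟨ρ, hρ, hρrs⟩ := exists_between (lt_min hr hs)
  have hsub : closedBall x ρ ⊆ U :=
    (closedBall_subset_ball (hρrs.trans_le (min_le_left _ _))).trans hrU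
  set W : EuclideanSpace ℝ (Fin d) → ℝ := fun y => (ρ ^ 2 - ‖y - x‖ ^ 2) ^ 2 with hW
  have hWpoly : ∀ y, polyFun x (ballWeight d ρ ^ 2) y = (W y : ℂ) := by
    intro y
    rw [pow_two, polyFun_mul, polyFun_ballWeight, hW]
    push_cast
    ring
  have hWc : Continuous W := by fun_prop
  have hWi : IntegrableOn W (ball x ρ) :=
    (hWc.continuousOn.integrableOn_compact (isCompact_closedBall x ρ)).mono_set
      ball_subset_closedBall
  have hWpos : 0 < ∫ y in ball x ρ, W y := by
    rw [setIntegral_pos_iff_support_of_nonneg_ae (Eventually.of_forall fun _ => by positivity) hWi]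
    refine (measure_ball_pos volume x hρ).trans_le (measure_mono fun y hy => ⟨?_, hy⟩)
    rw [mem_ball, dist_eq_norm] at hy
    have := pow_lt_pow_left₀ hy (norm_nonneg _) two_ne_zero
    exact pow_ne_zero 2 (sub_pos.2 this).ne'
  have hWCi : IntegrableOn (fun y => (W y : ℂ)) (ball x ρ) := hWi.ofReal
  have hhi : IntegrableOn (fun y => (W y : ℂ) * h y) (ball x ρ) :=
    (ContinuousOn.integrableOn_compact (isCompact_closedBall x ρ)
      ((Complex.continuous_ofReal.comp hWc).continuousOn.mul (hc.mono hsub))).mono_set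
      ball_subset_closedBall
  have h1 : ∫ y in ball x ρ, (W y : ℂ) * (h x - h y) = ((∫ y in ball x ρ, W y : ℝ) : ℂ) * h x := by
    simp_rw [mul_sub]
    rw [integral_sub (hWCi.mul_const _) hhi, integral_mul_const, integral_complex_ofReal]
    have := hz ρ hρ hsub
    simp_rw [hWpoly] at this
    rw [this, sub_zero]
  have h2 : ‖∫ y in ball x ρ, (W y : ℂ) * (h x - h y)‖ ≤ ∫ y in ball x ρ, W y * ε := by
    refine norm_integral_le_of_norm_le (hWi.mul_const ε) ?_
    refine (ae_restrict_mem measurableSet_ball).mono fun y hy => ?_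
    rw [norm_mul, Complex.norm_real, Real.norm_of_nonneg (by positivity)]
    have := hsε (lt_trans (mem_ball.1 hy) (hρrs.trans_le (min_le_right _ _)))
    rw [dist_comm, dist_eq_norm] at this
    gcongr
  rw [h1, integral_mul_const, norm_mul, Complex.norm_real, Real.norm_of_nonneg hWpos.le] at h2
  exact le_of_mul_le_mul_left h2 hWpos

/-- An `L²` limit of harmonic functions is harmonic. By the mean value property the harmonic
functions converge pointwise, to a function which is locally a convolution with a bump function,
hence `C²`; by Green's formula its Laplacian has zero weighted means over balls. -/
theorem isClosed_harmonicBergman {Ω : Set (EuclideanSpace ℝ (Fin d))} (hΩ : IsOpen Ω) :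
    IsClosed (harmonicBergman Ω : Set (Lp ℂ 2 (volume.restrict Ω))) := by
  refine IsSeqClosed.isClosed fun F f hF hFf => ?_
  choose u hu hFu using hF
  -- convergence of integrals against functions supported in a compact subset of `Ω`
  have hconv : ∀ ψ : EuclideanSpace ℝ (Fin d) → ℂ, MemLp ψ 2 (volume.restrict Ω) →
      Tendsto (fun n => ∫ y in Ω, ψ y * u n y) atTop (𝓝 (∫ y in Ω, ψ y * f y)) := by
    intro ψ hψ
    refine ((continuous_integral_mul_Lp hψ).tendsto f |>.comp hFf).congr fun n => ?_
    refine integral_congr_ae ?_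
    filter_upwards [hFu n] with y hy
    rw [hy]
  have hψ2 : ∀ (x : EuclideanSpace ℝ (Fin d)) (δ : ℝ), 0 < δ →
      MemLp (fun y => (radialBump d δ (y - x) : ℂ)) 2 (volume.restrict Ω) := by
    intro x δ hδ
    have hc : Continuous fun y => (radialBump d δ (y - x) : ℂ) :=
      Complex.continuous_ofReal.comp ((contDiff_radialBump δ).continuous.comp
        (continuous_id.sub continuous_const))
    refine (hc.memLp_of_hasCompactSupport ?_).restrict Ω
    refine HasCompactSupport.intro (isCompact_closedBall x δ) fun y hy => ?_
    rw [radialBump_eq_zero hδ.le, Complex.ofReal_zero]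
    rw [mem_ball_zero_iff, not_lt, ← dist_eq_norm]
    rw [mem_closedBall, not_le] at hy
    exact hy.le
  have hmean : ∀ (x : EuclideanSpace ℝ (Fin d)) (δ : ℝ), 0 < δ → closedBall x (2 * δ) ⊆ Ω →
      Tendsto (fun n => u n x) atTop (𝓝 (((∫ y, radialBump d δ y : ℝ) : ℂ)⁻¹ *
        ∫ y in Ω, radialBump d δ (y - x) * f y)) := by
    intro x δ hδ hsub
    have hκ : ((∫ y, radialBump d δ y : ℝ) : ℂ) ≠ 0 :=
      Complex.ofReal_ne_zero.2 (integral_radialBump_pos hδ).ne'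
    refine ((hconv _ (hψ2 x δ hδ)).const_mul _).congr fun n => ?_
    have h1 : ∫ y in Ω, (radialBump d δ (y - x) : ℂ) * u n y =
        ∫ y, radialBump d δ (y - x) • u n y := by
      refine setIntegral_eq_integral_of_forall_compl_eq_zero fun y hy => ?_
      rw [radialBump_eq_zero hδ.le, Complex.ofReal_zero, zero_mul]
      intro h
      rw [mem_ball_zero_iff, ← dist_eq_norm] at h
      exact hy (hsub (mem_closedBall.2 (by linarith)))
    rw [h1, integral_radialBump_smul_harmonic hΩ (hu n) hδ hsub, inv_mul_cancel_left₀ hκ]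
  have hδ : ∀ x ∈ Ω, ∃ δ > 0, closedBall x (4 * δ) ⊆ Ω := by
    intro x hx
    obtain ⟨r, hr, hrU⟩ := Metric.isOpen_iff.1 hΩ x hx
    exact ⟨r / 8, by positivity, (closedBall_subset_ball (by linarith)).trans hrU⟩
  have hlimex : ∀ x, ∃ z, x ∈ Ω → Tendsto (fun n => u n x) atTop (𝓝 z) := by
    intro x
    by_cases hx : x ∈ Ω
    · obtain ⟨δ, hδ, hsub⟩ := hδ x hx
      exact ⟨_, fun _ => hmean x δ hδ
        ((closedBall_subset_closedBall (by linarith)).trans hsub)⟩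
    · exact ⟨0, fun h => absurd h hx⟩
  choose v hv using hlimex
  have hfv : f =ᵐ[volume.restrict Ω] v := by
    obtain ⟨ns, hns, hae⟩ := (tendstoInMeasure_of_tendsto_Lp hFf).exists_seq_tendsto_ae
    filter_upwards [hae, ae_all_iff.2 hFu, ae_restrict_mem hΩ.measurableSet] with y hy hyu hyΩ
    refine tendsto_nhds_unique hy ?_
    simp_rw [hyu]
    exact (hv y hyΩ).comp hns.tendsto_atTop
  have hvC : ∀ x ∈ Ω, ContDiffAt ℝ 2 v x := by
    intro x hx
    obtain ⟨δ, hδ, hsub⟩ := hδ x hx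
    have hloc : LocallyIntegrable (Ω.indicator f) := by
      have : MemLp (Ω.indicator f) 2 volume :=
        (memLp_indicator_iff_restrict hΩ.measurableSet).2 (Lp.memLp f)
      exact this.locallyIntegrable one_le_two
    have hconvC := (hasCompactSupport_radialBump hδ.le).contDiff_convolution_left
      (ContinuousLinearMap.lsmul ℝ ℝ) (contDiff_radialBump (d := d) δ) hloc
    refine (contDiff_const.mul hconvC).contDiffAt.congr_of_eventuallyEq
      (f₁ := v) (f := fun z => ((∫ y, radialBump d δ y : ℝ) : ℂ)⁻¹ * _) ?_
    filter_upwards [ball_mem_nhds x hδ] with z hz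
    have hzsub : closedBall z (2 * δ) ⊆ Ω := by
      refine (closedBall_subset_closedBall' ?_).trans hsub
      linarith [mem_ball.1 hz]
    have hzΩ : z ∈ Ω := hzsub (mem_closedBall_self (by positivity))
    rw [tendsto_nhds_unique (hv z hzΩ) (hmean z δ hδ hzsub), convolution_lsmul_swap]
    congr 1
    rw [← integral_indicator hΩ.measurableSet]
    congr 1
    funext y
    by_cases hy : y ∈ Ω
    · simp [hy, radialBump_sub_comm δ z y]
    · simp [hy]
  have hvCon : ContDiffOn ℝ 2 v Ω := fun x hx => (hvC x hx).contDiffWithinAt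
  have hΔc : ContinuousOn (Δ v) Ω := by
    intro x hx
    have hf1 : ∀ i, ContDiffOn ℝ 1 (fun y => fderiv ℝ v y (EuclideanSpace.single i 1)) Ω :=
      fun i => (hvCon.fderiv_of_isOpen hΩ (by norm_num)).clm_apply contDiffOn_const
    have : ContinuousOn (fun y => ∑ i, fderiv ℝ
        (fun z => fderiv ℝ v z (EuclideanSpace.single i 1)) y (EuclideanSpace.single i 1)) Ω :=
      continuousOn_finsetSum _ fun i _ =>
        ((hf1 i).continuousOn_fderiv_of_isOpen hΩ le_rfl).clm_apply continuousOn_const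
    exact (this.congr fun y hy => laplacian_eq_sum_fderiv_fderiv (hvC y hy)) x hx
  have hΔ0 : ∀ x ∈ Ω, Δ v x = 0 := by
    intro x hx
    refine eq_zero_of_integral_ball_weight_eq_zero hΩ hx hΔc fun ρ hρ hsub => ?_
    have hbΩ : ball x ρ ⊆ Ω := ball_subset_closedBall.trans hsub
    have hg : ∀ f, ContDiffOn ℝ 2 f Ω → _ := fun f hf =>
      integral_ball_green hΩ hsub (f := f) hf 1
    simp only [mul_one] at hg
    rw [← hg v hvCon]
    set q := polyLaplacian d (ballWeight d ρ ^ 2) with hq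
    have hind : ∀ f : EuclideanSpace ℝ (Fin d) → ℂ, ∫ y in ball x ρ, f y * polyFun x q y =
        ∫ y in Ω, (ball x ρ).indicator (polyFun x q) y * f y := by
      intro f
      rw [← Set.inter_eq_self_of_subset_right hbΩ, ← setIntegral_indicator measurableSet_ball]
      congr 1
      funext y
      by_cases hy : y ∈ ball x ρ
      · simp only [Set.inter_eq_self_of_subset_right hbΩ, Set.indicator_of_mem hy, mul_comm]
      · simp [Set.inter_eq_self_of_subset_right hbΩ, Set.indicator_of_notMem hy]
    have hq2 : MemLp ((ball x ρ).indicator (polyFun x q)) 2 (volume.restrict Ω) := by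
      refine MemLp.restrict Ω ?_
      rw [memLp_indicator_iff_restrict measurableSet_ball]
      obtain ⟨M, hM⟩ := (isCompact_closedBall x ρ).exists_bound_of_continuousOn
        (continuous_polyFun x q).continuousOn
      have : IsFiniteMeasure (volume.restrict (ball x ρ)) :=
        isFiniteMeasure_restrict.2 measure_ball_lt_top.ne
      exact MemLp.of_bound (continuous_polyFun x q).aestronglyMeasurable M
        ((ae_restrict_mem measurableSet_ball).mono fun y hy => hM y (ball_subset_closedBall hy))
    have hzero : ∀ n, ∫ y in Ω, (ball x ρ).indicator (polyFun x q) y * u n y = 0 := by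
      intro n
      rw [← hind, hg (u n) (hu n).contDiffOn]
      refine (setIntegral_congr_fun measurableSet_ball (g := fun _ => 0) fun y hy => ?_).trans
        (by simp)
      have h0 : Δ (u n) y = 0 := (hu n y (hbΩ hy)).2.self_of_nhds
      simp only [h0, mul_zero]
    have hcongr : ∫ y in Ω, (ball x ρ).indicator (polyFun x q) y * f y =
        ∫ y in Ω, (ball x ρ).indicator (polyFun x q) y * v y :=
      integral_congr_ae (hfv.mono fun y hy => by simp only [hy])
    rw [hind, ← hcongr]
    refine tendsto_nhds_unique (hconv _ hq2) ?_
    simp_rw [hzero]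
    exact tendsto_const_nhds
  exact ⟨v, fun x hx => ⟨hvC x hx, by
    filter_upwards [hΩ.mem_nhds hx] with y hy using hΔ0 y hy⟩, hfv⟩

theorem completeSpace_harmonicBergman {Ω : Set (EuclideanSpace ℝ (Fin d))} (hΩ : IsOpen Ω) :
    CompleteSpace (harmonicBergman Ω) :=
  (isClosed_harmonicBergman hΩ).completeSpace_coe

end Completeness

/-! ### Operators which are diagonal for an orthogonal family -/

section Diagonal

open Filter Topology Module

variable {H₁ H₂ : Type*} [NormedAddCommGroup H₁] [InnerProductSpace ℂ H₁] [CompleteSpace H₁]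
  [NormedAddCommGroup H₂] [InnerProductSpace ℂ H₂] [CompleteSpace H₂]

/-- The operator `J` maps the pairwise orthogonal finite-dimensional subspaces `V k`, which
together are total, to pairwise orthogonal subspaces, and multiplies the inner product of `V k`
by `c k`. -/
structure IsDiagonalFor (J : H₁ →L[ℂ] H₂) (V : ℕ → Submodule ℂ H₁) (c : ℕ → ℝ) : Prop where
  finite : ∀ k, FiniteDimensional ℂ (V k)
  orthogonal : ∀ k l, k ≠ l → ∀ p ∈ V k, ∀ q ∈ V l, ⟪p, q⟫_ℂ = 0
  total : ∀ f, (∀ k, ∀ p ∈ V k, ⟪p, f⟫_ℂ = 0) → f = 0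
  inner_map : ∀ k, ∀ p ∈ V k, ∀ q ∈ V k, ⟪J p, J q⟫_ℂ = c k * ⟪p, q⟫_ℂ
  inner_map_ne : ∀ k l, k ≠ l → ∀ p ∈ V k, ∀ q ∈ V l, ⟪J p, J q⟫_ℂ = 0

namespace IsDiagonalFor

variable {J : H₁ →L[ℂ] H₂} {V : ℕ → Submodule ℂ H₁} {c : ℕ → ℝ}

theorem adjoint_comp_apply (h : IsDiagonalFor J V c) {k : ℕ} {p : H₁} (hp : p ∈ V k) :
    (ContinuousLinearMap.adjoint J ∘L J) p = (c k : ℂ) • p := by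
  refine sub_eq_zero.1 (h.total _ fun l q hq => ?_)
  rw [inner_sub_right, ContinuousLinearMap.comp_apply, ContinuousLinearMap.adjoint_inner_right,
    inner_smul_right]
  by_cases hkl : l = k
  · subst hkl
    rw [h.inner_map l q hq p hp, sub_self]
  · rw [h.inner_map_ne l k hkl q hq p hp, h.orthogonal l k hkl q hq p hp, mul_zero, sub_zero]

theorem inner_adjoint_comp (h : IsDiagonalFor J V c) {k : ℕ} {p : H₁} (hp : p ∈ V k) (f : H₁) :
    ⟪p, (ContinuousLinearMap.adjoint J ∘L J) f⟫_ℂ = c k * ⟪p, f⟫_ℂ := by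
  have h1 : ⟪p, (ContinuousLinearMap.adjoint J ∘L J) f⟫_ℂ =
      ⟪(ContinuousLinearMap.adjoint J ∘L J) p, f⟫_ℂ := by
    rw [ContinuousLinearMap.comp_apply, ContinuousLinearMap.comp_apply,
      ContinuousLinearMap.adjoint_inner_right, ContinuousLinearMap.adjoint_inner_left]
  rw [h1, h.adjoint_comp_apply hp, inner_smul_left, Complex.conj_ofReal]

theorem inner_eq_zero_of_eigen (h : IsDiagonalFor J V c) {k : ℕ} {μ : ℂ} (hμ : μ ≠ c k) {f : H₁}
    (hf : (ContinuousLinearMap.adjoint J ∘L J) f = μ • f) {p : H₁} (hp : p ∈ V k) :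
    ⟪p, f⟫_ℂ = 0 := by
  have h1 := h.inner_adjoint_comp hp f
  rw [hf, inner_smul_right, ← sub_eq_zero, ← sub_mul] at h1
  exact (mul_eq_zero.1 h1).resolve_left (sub_ne_zero.2 hμ)

theorem maxGenEigenspace_eq_eigenspace (J : H₁ →L[ℂ] H₂) (μ : ℂ) :
    End.maxGenEigenspace ((ContinuousLinearMap.adjoint J ∘L J : H₁ →L[ℂ] H₁) : H₁ →ₗ[ℂ] H₁) μ =
      End.eigenspace ((ContinuousLinearMap.adjoint J ∘L J : H₁ →L[ℂ] H₁) : H₁ →ₗ[ℂ] H₁) μ := by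
  have hs : ((ContinuousLinearMap.adjoint J ∘L J : H₁ →L[ℂ] H₁) : H₁ →ₗ[ℂ] H₁).IsSymmetric := by
    intro f g
    simp [ContinuousLinearMap.adjoint_inner_right, ContinuousLinearMap.adjoint_inner_left]
  exact hs.isFinitelySemisimple.maxGenEigenspace_eq_eigenspace μ

theorem maxGenEigenspace_eq (h : IsDiagonalFor J V c) (hc : Function.Injective c) (k : ℕ) :
    End.maxGenEigenspace ((ContinuousLinearMap.adjoint J ∘L J : H₁ →L[ℂ] H₁) : H₁ →ₗ[ℂ] H₁)
      (c k) = V k := by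
  rw [maxGenEigenspace_eq_eigenspace]
  ext f
  rw [End.mem_eigenspace_iff]
  refine ⟨fun hf => ?_, fun hf => h.adjoint_comp_apply hf⟩
  have := h.finite k
  have hdiff : f - (V k).starProjection f = 0 := by
    refine h.total _ fun l p hp => ?_
    by_cases hl : l = k
    · subst hl
      exact Submodule.inner_right_of_mem_orthogonal hp
        (Submodule.sub_starProjection_mem_orthogonal f)
    · rw [inner_sub_right, h.orthogonal l k hl p hp _ (Submodule.starProjection_apply_mem _ _),
        sub_zero]
      refine h.inner_eq_zero_of_eigen (k := l) (μ := c k) (fun he => hl ?_) hf hp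
      exact (hc (Complex.ofReal_injective he)).symm
  rw [sub_eq_zero.1 hdiff]
  exact Submodule.starProjection_apply_mem _ _

theorem maxGenEigenspace_eq_bot (h : IsDiagonalFor J V c) {μ : ℂ} (hμ : ∀ k, μ ≠ c k) :
    End.maxGenEigenspace ((ContinuousLinearMap.adjoint J ∘L J : H₁ →L[ℂ] H₁) : H₁ →ₗ[ℂ] H₁)
      μ = ⊥ := by
  rw [maxGenEigenspace_eq_eigenspace, eq_bot_iff]
  intro f hf
  rw [End.mem_eigenspace_iff] at hf
  exact h.total f fun k p hp => h.inner_eq_zero_of_eigen (hμ k) hf hp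

/-- On the orthogonal complement of the first `n` subspaces, `J` has norm at most `√(c n)`. -/
theorem norm_map_sq_le (h : IsDiagonalFor J V c) (hc : Antitone c) {n : ℕ} {g : H₁}
    (hg : ∀ k < n, ∀ p ∈ V k, ⟪p, g⟫_ℂ = 0) : ‖J g‖ ^ 2 ≤ c n * ‖g‖ ^ 2 := by
  have := h.finite
  have hsum : IsHilbertSum ℂ (fun k => V k) fun k => (V k).subtypeₗᵢ := by
    refine IsHilbertSum.mkInternal _ (fun k l hkl => ?_) ?_
    · rintro ⟨p, hp⟩ ⟨q, hq⟩
      exact h.orthogonal k l hkl p hp q hq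
    rw [top_le_iff, Submodule.topologicalClosure_eq_top_iff, eq_bot_iff]
    intro f hf
    exact h.total f fun k p hp =>
      Submodule.inner_right_of_mem_orthogonal (Submodule.mem_iSup_of_mem k hp) hf
  obtain ⟨w, hwV, hw⟩ : ∃ w : ℕ → H₁, (∀ k, w k ∈ V k) ∧ HasSum w g := by
    refine ⟨fun k => (hsum.linearIsometryEquiv g k : V k), fun k => Subtype.property _, ?_⟩
    simpa using hsum.hasSum_linearIsometryEquiv_symm (hsum.linearIsometryEquiv g)
  have hgw : ∀ k, ⟪w k, g⟫_ℂ = ((‖w k‖ ^ 2 : ℝ) : ℂ) := by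
    intro k
    have h1 := hw.mapL (innerSL ℂ (w k))
    have h2 : HasSum (fun l => innerSL ℂ (w k) (w l)) (innerSL ℂ (w k) (w k)) :=
      hasSum_single k fun l hl => h.orthogonal k l (Ne.symm hl) _ (hwV k) _ (hwV l)
    have h3 := h1.unique h2
    simp only [innerSL_apply_apply] at h3
    rw [h3, inner_self_eq_norm_sq_to_K]
    norm_cast
  have hgw' : ∀ k, ⟪g, w k⟫_ℂ = ((‖w k‖ ^ 2 : ℝ) : ℂ) := fun k => by
    rw [← inner_conj_symm, hgw, Complex.conj_ofReal]
  have hw0 : ∀ k < n, w k = 0 := by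
    intro k hk
    have h1 := hgw k
    rw [hg k hk _ (hwV k), eq_comm, Complex.ofReal_eq_zero] at h1
    simpa using h1
  have s1 : HasSum (fun k => ‖w k‖ ^ 2) (‖g‖ ^ 2) := by
    have h1 := hw.mapL (innerSL ℂ g)
    simp only [innerSL_apply_apply] at h1
    simp only [hgw', inner_self_eq_norm_sq_to_K] at h1
    refine Complex.hasSum_ofReal.1 ?_
    simpa using h1
  have s2 : HasSum (fun k => c k * ‖w k‖ ^ 2) (‖J g‖ ^ 2) := by
    have h1 := (hw.mapL (ContinuousLinearMap.adjoint J ∘L J)).mapL (innerSL ℂ g)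
    simp only [innerSL_apply_apply, h.adjoint_comp_apply (hwV _), inner_smul_right, hgw',
      ContinuousLinearMap.comp_apply, ContinuousLinearMap.adjoint_inner_right,
      inner_self_eq_norm_sq_to_K] at h1
    refine Complex.hasSum_ofReal.1 ?_
    simpa using h1
  refine hasSum_le (fun k => ?_) s2 (s1.mul_left (c n))
  rcases lt_or_ge k n with hk | hk
  · simp [hw0 k hk]
  · exact mul_le_mul_of_nonneg_right (hc hk) (by positivity)

/-- `J` is the norm limit of its compositions with the projections onto the finite-dimensional sums
of the first `n` subspaces. -/
theorem isCompactOperator (h : IsDiagonalFor J V c) (hc : Antitone c)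
    (hc0 : Tendsto c atTop (𝓝 0)) : IsCompactOperator J := by
  have := h.finite
  set S : ℕ → Submodule ℂ H₁ := fun n => (Finset.range n).sup V with hS
  have hSfin : ∀ n, FiniteDimensional ℂ (S n) := fun n =>
    Submodule.finiteDimensional_finset_sup _ _
  refine isCompactOperator_of_tendsto (l := atTop) (F := fun n => J ∘L (S n).starProjection) ?_
    (Eventually.of_forall fun n => ?_)
  · rw [tendsto_iff_norm_sub_tendsto_zero]
    have hlim : Tendsto (fun n => √(c n)) atTop (𝓝 0) := by
      simpa [Function.comp_def] using (Real.continuous_sqrt.tendsto 0).comp hc0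
    refine squeeze_zero (fun _ => norm_nonneg _) (fun n => ?_) hlim
    rw [norm_sub_rev]
    refine ContinuousLinearMap.opNorm_le_bound _ (Real.sqrt_nonneg _) fun f => ?_
    have hg : ∀ k < n, ∀ p ∈ V k, ⟪p, f - (S n).starProjection f⟫_ℂ = 0 := fun k hk p hp =>
      Submodule.inner_right_of_mem_orthogonal
        (Finset.le_sup (f := V) (Finset.mem_range.2 hk) hp)
        (Submodule.sub_starProjection_mem_orthogonal f)
    have h1 := h.norm_map_sq_le hc hg
    have h2 : ‖f - (S n).starProjection f‖ ≤ ‖f‖ := by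
      rw [← Submodule.starProjection_orthogonal_val]
      exact Submodule.norm_starProjection_apply_le _ _
    have hcn : 0 ≤ c n := hc.le_of_tendsto hc0 n
    rw [sub_apply, ContinuousLinearMap.comp_apply, ← map_sub]
    refine (abs_le_of_sq_le_sq' ?_ (by positivity)).2
    rw [mul_pow, Real.sq_sqrt hcn]
    exact h1.trans (by gcongr)
  · have : ProperSpace (S n) := FiniteDimensional.proper ℂ (S n)
    have hcomp : IsCompactOperator ((S n).orthogonalProjectionOnto) :=
      isCompactOperator_of_locallyCompactSpace_dom _
    exact hcomp.clm_comp (J ∘L (S n).subtypeL)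

end IsDiagonalFor

end Diagonal

/-! ### Monotone sequences with prescribed multiplicities -/

section Multiplicities

theorem encard_pnat_Ioc (a b : ℕ) : {n : ℕ+ | a < (n : ℕ) ∧ (n : ℕ) ≤ b}.encard = (b - a : ℕ) := by
  have h : PNat.val '' {n : ℕ+ | a < (n : ℕ) ∧ (n : ℕ) ≤ b} = (Finset.Ioc a b : Set ℕ) := by
    ext i
    simp only [Set.mem_image, Set.mem_ofPred_eq, Finset.coe_Ioc, Set.mem_Ioc]
    constructor
    · rintro ⟨n, hn, rfl⟩
      exact hn
    · intro hi
      exact ⟨⟨i, by omega⟩, hi, rfl⟩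
  rw [← PNat.coe_injective.encard_image, show ((fun n : ℕ+ => (n : ℕ)) '' _) = _ from h,
    Set.encard_coe_eq_coe_finsetCard, Nat.card_Ioc]

theorem encard_pnat_Iic (b : ℕ) : {n : ℕ+ | (n : ℕ) ≤ b}.encard = b := by
  simpa using encard_pnat_Ioc 0 b

theorem IsLowerSet.mem_iff_le_of_encard_eq {S : Set ℕ+} (hS : IsLowerSet S) {m : ℕ}
    (hm : S.encard = m) (n : ℕ+) : n ∈ S ↔ (n : ℕ) ≤ m := by
  constructor
  · intro hn
    have h1 : {i : ℕ+ | (i : ℕ) ≤ n} ⊆ S := fun i hi => hS (PNat.coe_le_coe _ _ |>.1 hi) hn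
    have h2 := Set.encard_le_encard h1
    rw [encard_pnat_Iic, hm] at h2
    exact_mod_cast h2
  · intro hn
    by_contra hnS
    have h1 : S ⊆ {i : ℕ+ | (i : ℕ) ≤ (n : ℕ) - 1} := by
      intro i hi
      by_contra h
      refine hnS (hS ?_ hi)
      rw [← PNat.coe_le_coe]
      simp only [Set.mem_ofPred_eq] at h
      omega
    have h2 := Set.encard_le_encard h1
    rw [encard_pnat_Iic, hm] at h2
    have h3 : m ≤ (n : ℕ) - 1 := by exact_mod_cast h2
    have := n.pos
    omega

variable {N : ℕ → ℕ} {c : ℕ → ℝ}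

/-- In a sequence of decreasing modulus whose nonzero terms are the `c k`, with multiplicity
`N k`, the terms of modulus at least `c k` are the first `N 0 + ⋯ + N k`. -/
theorem le_norm_iff_of_multiplicities (hc : StrictAnti c) (hpos : ∀ k, 0 < c k) {l : ℕ+ → ℂ}
    (hl : Antitone fun n => ‖l n‖) (hN : ∀ k, {n | l n = c k}.encard = N k)
    (h0 : ∀ n, l n ≠ 0 → ∃ k, l n = c k) (k : ℕ) (n : ℕ+) :
    c k ≤ ‖l n‖ ↔ (n : ℕ) ≤ ∑ j ∈ Finset.range (k + 1), N j := by
  have hnorm : ∀ n j, l n = c j → ‖l n‖ = c j := fun n j h => by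
    rw [h, Complex.norm_real, Real.norm_of_nonneg (hpos j).le]
  have hcard : ∀ k, {n | c k ≤ ‖l n‖}.encard = (∑ j ∈ Finset.range (k + 1), N j : ℕ) := by
    intro k
    induction k with
    | zero =>
      rw [Finset.sum_range_one, ← hN 0]
      congr 1
      ext n
      simp only [Set.mem_ofPred_eq]
      refine ⟨fun h => ?_, fun h => (hnorm n 0 h).ge⟩
      obtain ⟨j, hj⟩ := h0 n (norm_pos_iff.1 ((hpos 0).trans_le h))
      rw [hnorm n j hj] at h
      rw [hj, Nat.le_zero.1 (hc.le_iff_ge.1 h)]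
    | succ k ih =>
      have hunion : {n | c (k + 1) ≤ ‖l n‖} = {n | c k ≤ ‖l n‖} ∪ {n | l n = c (k + 1)} := by
        ext n
        simp only [Set.mem_ofPred_eq, Set.mem_union]
        constructor
        · intro h
          obtain ⟨j, hj⟩ := h0 n (norm_pos_iff.1 ((hpos (k + 1)).trans_le h))
          rw [hnorm n j hj] at h ⊢
          rcases (hc.le_iff_ge.1 h).lt_or_eq with hjk | rfl
          · exact Or.inl (hc.antitone (Nat.lt_succ_iff.1 hjk))
          · exact Or.inr hj
        · rintro (h | h)
          · exact (hc k.lt_succ_self).le.trans h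
          · exact (hnorm n _ h).ge
      rw [hunion, Set.encard_union_eq, ih, hN, Finset.sum_range_succ _ (k + 1)]
      · push_cast; rfl
      · rw [Set.disjoint_left]
        intro n h1 h2
        simp only [Set.mem_ofPred_eq] at h1 h2
        rw [hnorm n _ h2] at h1
        exact (hc k.lt_succ_self).not_ge h1
  have hlow : IsLowerSet {n | c k ≤ ‖l n‖} := fun m n hmn h => h.trans (hl hmn)
  exact hlow.mem_iff_le_of_encard_eq (hcard k) n

theorem eq_of_multiplicities (hc : StrictAnti c) (hpos : ∀ k, 0 < c k) {l : ℕ+ → ℂ}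
    (hl : Antitone fun n => ‖l n‖) (hN : ∀ k, {n | l n = c k}.encard = N k)
    (h0 : ∀ n, l n ≠ 0 → ∃ k, l n = c k) {k : ℕ} {n : ℕ+}
    (h1 : ∑ j ∈ Finset.range k, N j < n) (h2 : (n : ℕ) ≤ ∑ j ∈ Finset.range (k + 1), N j) :
    l n = c k := by
  have hiff := le_norm_iff_of_multiplicities hc hpos hl hN h0
  have hk := (hiff k n).2 h2
  obtain ⟨j, hj⟩ := h0 n (norm_pos_iff.1 ((hpos k).trans_le hk))
  have hnj : ‖l n‖ = c j := by
    rw [hj, Complex.norm_real, Real.norm_of_nonneg (hpos j).le]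
  rw [hnj] at hk
  rcases (hc.le_iff_ge.1 hk).lt_or_eq with hjk | rfl
  · have h3 := (hiff j n).1 hnj.ge
    have h4 : ∑ i ∈ Finset.range (j + 1), N i ≤ ∑ i ∈ Finset.range k, N i :=
      Finset.sum_le_sum_of_subset (Finset.range_mono hjk)
    omega
  · exact hj

open Classical in
theorem exists_sequence_with_multiplicities (N : ℕ → ℕ) (hc : StrictAnti c)
    (hpos : ∀ k, 0 < c k) : ∃ l : ℕ+ → ℝ, Antitone l ∧ (∀ n, 0 ≤ l n) ∧
      (∀ k, {n | l n = c k}.encard = N k) ∧ ∀ n, l n ≠ 0 → ∃ k, l n = c k := by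
  set H : ℕ → ℕ := fun k => ∑ j ∈ Finset.range k, N j with hH
  have hHmono : Monotone H := fun a b hab =>
    Finset.sum_le_sum_of_subset (Finset.range_mono hab)
  -- the `n`-th term is `c k` for the least `k` such that `n ≤ N 0 + ⋯ + N k`
  let l : ℕ+ → ℝ := fun n => if h : ∃ k, (n : ℕ) ≤ H (k + 1) then c (Nat.find h) else 0
  have hl : ∀ n k, l n = c k ↔ H k < n ∧ (n : ℕ) ≤ H (k + 1) := by
    intro n k
    by_cases h : ∃ k, (n : ℕ) ≤ H (k + 1)
    · simp only [l, dif_pos h, hc.injective.eq_iff, Nat.find_eq_iff]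
      rw [and_comm]
      refine and_congr_left fun _ => ⟨fun hk => ?_, fun hk j hj hn => ?_⟩
      · cases k with
        | zero => simp [hH]
        | succ k => exact not_le.1 (hk k k.lt_succ_self)
      · have := hHmono (Nat.succ_le_iff.2 hj)
        simp only [Nat.succ_eq_add_one] at this
        omega
    · simp only [l, dif_neg h]
      exact ⟨fun h' => absurd h' (hpos k).ne, fun h' => absurd ⟨k, h'.2⟩ h⟩
  have hl0 : ∀ n, 0 ≤ l n := by
    intro n
    by_cases h : ∃ k, (n : ℕ) ≤ H (k + 1)
    · simp only [l, dif_pos h]; exact (hpos _).le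
    · simp only [l, dif_neg h]; exact le_rfl
  refine ⟨l, fun m n hmn => ?_, hl0, fun k => ?_, fun n hn => ?_⟩
  · by_cases h : ∃ k, (n : ℕ) ≤ H (k + 1)
    · have hmn' : (m : ℕ) ≤ n := hmn
      have hm : ∃ k, (m : ℕ) ≤ H (k + 1) := h.imp fun k hk => hmn'.trans hk
      simp only [l, dif_pos h, dif_pos hm]
      exact hc.antitone (Nat.find_mono fun k hk => hmn'.trans hk)
    · have : l n = 0 := dif_neg h
      rw [this]
      exact hl0 m
  · simp_rw [hl]
    rw [encard_pnat_Ioc]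
    simp only [hH, Finset.sum_range_succ, Nat.add_sub_cancel_left]
  · by_cases h : ∃ k, (n : ℕ) ≤ H (k + 1)
    · exact ⟨Nat.find h, dif_pos h⟩
    · exact absurd (dif_neg h) hn

end Multiplicities

/-! ### Dimensions of spaces of harmonic polynomials -/

section Dimensions

open Metric Filter Topology MvPolynomial Module

variable {d : ℕ}

theorem mem_harmonicPolynomials_inf_homogeneous {k : ℕ} {p : MvPolynomial (Fin d) ℂ} :
    p ∈ harmonicPolynomials d ⊓ homogeneousSubmodule (Fin d) ℂ k ↔
      polyLaplacian d p = 0 ∧ p.IsHomogeneous k := by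
  rw [Submodule.mem_inf, mem_harmonicPolynomials_iff, mem_homogeneousSubmodule]

theorem homogeneousSubmodule_le_restrictTotalDegree (k : ℕ) :
    homogeneousSubmodule (Fin d) ℂ k ≤ restrictTotalDegree (Fin d) ℂ k := fun p hp =>
  (mem_restrictTotalDegree _ _ _).2 ((mem_homogeneousSubmodule k p).1 hp).totalDegree_le

instance finiteDimensional_harmonicPolynomials_inf_homogeneous (k : ℕ) : FiniteDimensional ℂ
    ↥(harmonicPolynomials d ⊓ homogeneousSubmodule (Fin d) ℂ k) :=
  Submodule.finiteDimensional_of_le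
    (inf_le_right.trans (homogeneousSubmodule_le_restrictTotalDegree k))

theorem polyFun_smul_of_isHomogeneous {k : ℕ} {p : MvPolynomial (Fin d) ℂ}
    (hp : p.IsHomogeneous k) (t : ℝ) (y : EuclideanSpace ℝ (Fin d)) :
    polyFun 0 p (t • y) = (t : ℂ) ^ k * polyFun 0 p y := by
  simp only [polyFun, aeval_def, eval₂_eq', Finset.mul_sum]
  refine Finset.sum_congr rfl fun m hm => ?_
  have hdeg : ∑ i, m i = k := by
    rw [hp.degree_eq_sum_deg_support hm]
    exact (Finset.sum_subset (Finset.subset_univ _) fun i _ hi => Finsupp.notMem_support_iff.1 hi).symm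
  simp [mul_pow, Finset.prod_mul_distrib, Finset.prod_pow_eq_pow_sum, hdeg]
  ring

/-- A homogeneous polynomial vanishing on the unit sphere is zero. -/
theorem eq_zero_of_restrictToSphere_eq_zero (hd : 1 ≤ d) {k : ℕ} {p : MvPolynomial (Fin d) ℂ}
    (hp : p.IsHomogeneous k) (h : restrictToSphere d p = 0) : p = 0 := by
  have hs : ∀ y : EuclideanSpace ℝ (Fin d), ‖y‖ = 1 → polyFun 0 p y = 0 := by
    intro y hy
    have := congrFun h ⟨y, by simpa using hy⟩
    simpa [restrictToSphere, polyFun] using this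
  have hnz : ballWeight d 0 ≠ 0 := by
    intro h0
    have := polyFun_ballWeight (0 : EuclideanSpace ℝ (Fin d)) 0 (EuclideanSpace.single ⟨0, hd⟩ 1)
    rw [h0, polyFun_zero, eq_comm, Complex.ofReal_eq_zero] at this
    simp at this
  have hmul : ballWeight d 0 * p = 0 := by
    refine eq_zero_of_polyFun_eqOn_ball (c := 0) one_pos fun y _ => ?_
    rw [polyFun_mul, polyFun_ballWeight]
    by_cases hy : y = 0
    · simp [hy]
    · have hy' : ‖y‖ ≠ 0 := norm_ne_zero_iff.2 hy
      have h1 : y = ‖y‖ • (‖y‖⁻¹ • y) := by rw [smul_smul, mul_inv_cancel₀ hy', one_smul]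
      have h2 : polyFun 0 p (‖y‖⁻¹ • y) = 0 := hs _ (by
        rw [norm_smul, norm_inv, norm_norm, inv_mul_cancel₀ hy'])
      rw [h1, polyFun_smul_of_isHomogeneous hp, h2, mul_zero, mul_zero]
  exact (mul_eq_zero.1 hmul).resolve_left hnz

theorem finrank_harmonicHomogeneous (hd : 1 ≤ d) (k : ℕ) :
    finrank ℂ ↥(harmonicPolynomials d ⊓ homogeneousSubmodule (Fin d) ℂ k) =
      sphericalHarmonicsDim d k := by
  have hinj : Function.Injective ((restrictToSphere d).domRestrict
      (harmonicPolynomials d ⊓ homogeneousSubmodule (Fin d) ℂ k)) := by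
    rw [← LinearMap.ker_eq_bot, LinearMap.ker_eq_bot']
    rintro ⟨p, hp⟩ h0
    exact Subtype.ext (eq_zero_of_restrictToSphere_eq_zero hd
      (mem_harmonicPolynomials_inf_homogeneous.1 hp).2 h0)
  rw [sphericalHarmonicsDim, sphericalHarmonics, ← LinearMap.finrank_range_of_inj hinj,
    LinearMap.range_domRestrict]

theorem polyLaplacian_homogeneousComponent (k : ℕ) {p : MvPolynomial (Fin d) ℂ}
    (hp : polyLaplacian d p = 0) : polyLaplacian d (homogeneousComponent k p) = 0 := by
  ext m
  have h := congrArg (coeff m) hp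
  rw [polyLaplacian_apply, coeff_sum] at h ⊢
  simp only [coeff_pderiv, coeff_homogeneousComponent, map_add, Finsupp.degree_single] at h ⊢
  by_cases hk : m.degree + 1 + 1 = k
  · simpa only [if_pos hk] using h
  · simp [hk]

theorem finrank_harmonicPolynomials_inf_restrictTotalDegree (hd : 1 ≤ d) (k : ℕ) :
    finrank ℂ ↥(harmonicPolynomials d ⊓ restrictTotalDegree (Fin d) ℂ k) = harmonicDim d k := by
  have hdim : ∀ j : ℕ, harmonicDim d j = ∑ l ∈ Finset.range (j + 1), sphericalHarmonicsDim d l :=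
    fun j => rfl
  induction k with
  | zero =>
    rw [hdim, zero_add, Finset.sum_range_one, ← finrank_harmonicHomogeneous hd 0]
    rw [show restrictTotalDegree (Fin d) ℂ 0 = homogeneousSubmodule (Fin d) ℂ 0 from ?_]
    ext p
    rw [mem_restrictTotalDegree, mem_homogeneousSubmodule, Nat.le_zero,
      totalDegree_zero_iff_isHomogeneous]
  | succ k ih =>
    rw [hdim, Finset.sum_range_succ, ← hdim k, ← ih, ← finrank_harmonicHomogeneous hd (k + 1)]
    have hW : ∀ j, FiniteDimensional ℂ ↥(harmonicPolynomials d ⊓ restrictTotalDegree (Fin d) ℂ j) :=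
      fun j => Submodule.finiteDimensional_of_le inf_le_right
    have hsup : harmonicPolynomials d ⊓ restrictTotalDegree (Fin d) ℂ (k + 1) =
        (harmonicPolynomials d ⊓ restrictTotalDegree (Fin d) ℂ k) ⊔
          (harmonicPolynomials d ⊓ homogeneousSubmodule (Fin d) ℂ (k + 1)) := by
      refine le_antisymm ?_ (sup_le (inf_le_inf_left _ fun p hp => ?_)
        (inf_le_inf_left _ (homogeneousSubmodule_le_restrictTotalDegree _)))
      · rintro p ⟨hp, hpk⟩
        have hh : homogeneousComponent (k + 1) p ∈ harmonicPolynomials d :=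
          mem_harmonicPolynomials_iff.2
            (polyLaplacian_homogeneousComponent _ (mem_harmonicPolynomials_iff.1 hp))
        rw [← sub_add_cancel p (homogeneousComponent (k + 1) p)]
        refine Submodule.add_mem_sup ⟨Submodule.sub_mem _ hp hh, ?_⟩
          ⟨hh, homogeneousComponent_mem (k + 1) p⟩
        refine (mem_restrictTotalDegree _ _ _).2 (Finset.sup_le fun m hm => ?_)
        rw [MvPolynomial.mem_support_iff, coeff_sub, coeff_homogeneousComponent] at hm
        change m.degree ≤ k
        by_cases hmk : m.degree = k + 1
        · simp [hmk] at hm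
        · rw [if_neg hmk, sub_zero] at hm
          have h1 : m.degree ≤ p.totalDegree := le_totalDegree (MvPolynomial.mem_support_iff.2 hm)
          have h2 := (mem_restrictTotalDegree _ _ _).1 hpk
          omega
      · rw [mem_restrictTotalDegree] at hp ⊢
        omega
    have hinf : (harmonicPolynomials d ⊓ restrictTotalDegree (Fin d) ℂ k) ⊓
        (harmonicPolynomials d ⊓ homogeneousSubmodule (Fin d) ℂ (k + 1)) = ⊥ := by
      rw [eq_bot_iff]
      rintro p ⟨⟨_, h1⟩, ⟨_, h2⟩⟩
      by_contra hp0
      have h3 := ((mem_homogeneousSubmodule _ _).1 h2).totalDegree hp0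
      have h4 := (mem_restrictTotalDegree _ _ _).1 h1
      omega
    have h := Submodule.finrank_sup_add_finrank_inf_eq
      (harmonicPolynomials d ⊓ restrictTotalDegree (Fin d) ℂ k)
      (harmonicPolynomials d ⊓ homogeneousSubmodule (Fin d) ℂ (k + 1))
    rw [← hsup, hinf, finrank_bot, add_zero] at h
    exact h

/-- In dimension at least two, `(X₀ + i X₁) ^ k` is harmonic. -/
theorem sphericalHarmonicsDim_pos (hd : 2 ≤ d) (k : ℕ) : 0 < sphericalHarmonicsDim d k := by
  rw [← finrank_harmonicHomogeneous (by omega) k]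
  refine Nat.pos_of_ne_zero fun h0 => ?_
  set i₀ : Fin d := ⟨0, by omega⟩
  set i₁ : Fin d := ⟨1, by omega⟩
  have hne : i₀ ≠ i₁ := by simp [i₀, i₁]
  set q : MvPolynomial (Fin d) ℂ := X i₀ + C Complex.I * X i₁ with hq
  have hq1 : q.IsHomogeneous 1 := (isHomogeneous_X ℂ i₀).add (isHomogeneous_C_mul_X _ _)
  set a : Fin d → ℂ := fun i => (if i = i₀ then 1 else 0) + Complex.I * (if i = i₁ then 1 else 0)
    with ha
  have hqd : ∀ i, pderiv i q = C (a i) := by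
    intro i
    rw [hq, ha]
    simp only [map_add, pderiv_X, Derivation.leibniz, pderiv_C, smul_eq_mul, map_mul]
    by_cases h0 : i = i₀ <;> by_cases h1 : i = i₁ <;> simp [h0, h1, hne, hne.symm]
  have hlap : polyLaplacian d (q ^ k) = 0 := by
    have : ∀ i, pderiv i (pderiv i (q ^ k)) =
        C ((a i) ^ 2) *
          ((k : MvPolynomial (Fin d) ℂ) * (((k - 1 : ℕ) : MvPolynomial (Fin d) ℂ) * q ^ (k - 1 - 1))) := by
      intro i
      simp only [Derivation.leibniz_pow, hqd, smul_eq_mul, nsmul_eq_mul, Derivation.leibniz,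
        pderiv_C, Derivation.map_natCast, map_pow]
      ring
    rw [polyLaplacian_apply]
    simp_rw [this]
    rw [← Finset.sum_mul, ← map_sum]
    have hsum : ∑ i : Fin d, a i ^ 2 = 0 := by
      rw [Finset.sum_eq_add i₀ i₁ hne]
      · simp [ha, hne, hne.symm]
      · intro i _ hi
        simp [ha, hi.1, hi.2]
      · simp
      · simp
    rw [hsum, map_zero, zero_mul]
  have hq0 : q ≠ 0 := by
    intro h
    have := hqd i₀
    rw [h, map_zero, eq_comm] at this
    simp [ha, hne] at this
  have hmem : q ^ k ∈ harmonicPolynomials d ⊓ homogeneousSubmodule (Fin d) ℂ k :=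
    mem_harmonicPolynomials_inf_homogeneous.2 ⟨hlap, by simpa using hq1.pow k⟩
  rw [Submodule.finrank_eq_zero] at h0
  rw [h0] at hmem
  exact pow_ne_zero k hq0 hmem

theorem eq_C_mul_X_pow_of_isHomogeneous {k : ℕ} {p : MvPolynomial (Fin 1) ℂ}
    (hp : p.IsHomogeneous k) : p = C (coeff (Finsupp.single 0 k) p) * X 0 ^ k := by
  ext m
  rw [coeff_C_mul, coeff_X_pow]
  have hm : m = Finsupp.single 0 (m 0) := Finsupp.unique_ext (by simp)
  by_cases h : m 0 = k
  · rw [if_pos (by rw [hm, h]), mul_one, ← h, ← hm]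
  · rw [hp.coeff_eq_zero (by rw [hm, Finsupp.degree_single]; exact h), if_neg, mul_zero]
    intro h'
    rw [← h'] at h
    simp at h

theorem sphericalHarmonicsDim_one (k : ℕ) :
    sphericalHarmonicsDim 1 k = if k ≤ 1 then 1 else 0 := by
  rw [← finrank_harmonicHomogeneous le_rfl k]
  have hlap : polyLaplacian 1 (X 0 ^ k) =
      (k : MvPolynomial (Fin 1) ℂ) *
        (((k - 1 : ℕ) : MvPolynomial (Fin 1) ℂ) * X 0 ^ (k - 1 - 1)) := by
    rw [polyLaplacian_apply]
    simp only [Finset.univ_unique, Fin.default_eq_zero, Finset.sum_singleton,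
      Derivation.leibniz_pow, pderiv_X_self, smul_eq_mul, nsmul_eq_mul, Derivation.leibniz,
      mul_one, Derivation.map_natCast, Derivation.map_one_eq_zero, mul_zero, zero_add, add_zero]
    ring
  have hX : (X 0 ^ k : MvPolynomial (Fin 1) ℂ).IsHomogeneous k := isHomogeneous_X_pow 0 k
  split_ifs with hk
  · rw [show harmonicPolynomials 1 ⊓ homogeneousSubmodule (Fin 1) ℂ k =
      Submodule.span ℂ {(X 0 ^ k : MvPolynomial (Fin 1) ℂ)} from ?_]
    · exact finrank_span_singleton (pow_ne_zero k (X_ne_zero 0))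
    refine le_antisymm (fun p hp => ?_) ?_
    · rw [eq_C_mul_X_pow_of_isHomogeneous (mem_harmonicPolynomials_inf_homogeneous.1 hp).2,
        ← smul_eq_C_mul]
      exact Submodule.smul_mem _ _ (Submodule.mem_span_singleton_self _)
    · rw [Submodule.span_singleton_le_iff_mem, mem_harmonicPolynomials_inf_homogeneous]
      refine ⟨?_, hX⟩
      rw [hlap]
      interval_cases k <;> simp
  · rw [Submodule.finrank_eq_zero, eq_bot_iff]
    intro p hp
    rw [mem_harmonicPolynomials_inf_homogeneous] at hp
    have h1 := eq_C_mul_X_pow_of_isHomogeneous hp.2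
    have h2 := hp.1
    rw [h1, ← smul_eq_C_mul, map_smul, hlap, smul_eq_zero] at h2
    rcases h2 with h2 | h2
    · rw [h1, h2]; simp
    · exfalso
      have h3 : ((k : ℕ) : MvPolynomial (Fin 1) ℂ) ≠ 0 := Nat.cast_ne_zero.2 (by omega)
      have h4 : ((k - 1 : ℕ) : MvPolynomial (Fin 1) ℂ) ≠ 0 := Nat.cast_ne_zero.2 (by omega)
      exact mul_ne_zero h3 (mul_ne_zero h4 (pow_ne_zero _ (X_ne_zero 0))) h2

end Dimensions

/-! ### Harmonic polynomials in the harmonic Bergman space of a ball -/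

section Bergman

open Metric Filter Topology MvPolynomial Module

variable {d : ℕ}

theorem memLp_polyFun (c : EuclideanSpace ℝ (Fin d)) (R : ℝ) (p : MvPolynomial (Fin d) ℂ) :
    MemLp (polyFun c p) 2 (volume.restrict (ball c R)) := by
  obtain ⟨M, hM⟩ := (isCompact_closedBall c R).exists_bound_of_continuousOn
    (continuous_polyFun c p).continuousOn
  have : IsFiniteMeasure (volume.restrict (ball c R)) :=
    isFiniteMeasure_restrict.2 measure_ball_lt_top.ne
  exact MemLp.of_bound (continuous_polyFun c p).aestronglyMeasurable M
    ((ae_restrict_mem measurableSet_ball).mono fun y hy => hM y (ball_subset_closedBall hy))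

/-- The class in `h²` of the ball about `c` of the function `y ↦ p (y - c)`, for a harmonic
polynomial `p`. -/
noncomputable def harmonicToBergman (c : EuclideanSpace ℝ (Fin d)) (R : ℝ) :
    harmonicPolynomials d →ₗ[ℂ] harmonicBergman (ball c R) where
  toFun p := ⟨(memLp_polyFun c R p).toLp, polyFun c p,
    harmonicOnNhd_polyFun c (mem_harmonicPolynomials_iff.1 p.2) _, MemLp.coeFn_toLp _⟩
  map_add' p q := by
    refine Subtype.ext ?_
    change _ = (memLp_polyFun c R p).toLp + (memLp_polyFun c R q).toLp
    rw [← MemLp.toLp_add]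
    exact MemLp.toLp_congr (memLp_polyFun c R _)
      ((memLp_polyFun c R _).add (memLp_polyFun c R _))
      (Eventually.of_forall fun y => polyFun_add c p q y)
  map_smul' a p := by
    refine Subtype.ext ?_
    change _ = a • (memLp_polyFun c R p).toLp
    rw [← MemLp.toLp_const_smul]
    exact MemLp.toLp_congr (memLp_polyFun c R _) ((memLp_polyFun c R _).const_smul a)
      (Eventually.of_forall fun y => polyFun_smul c a p y)

theorem coeFn_harmonicToBergman (c : EuclideanSpace ℝ (Fin d)) (R : ℝ)
    (p : harmonicPolynomials d) :
    (harmonicToBergman c R p : Lp ℂ 2 (volume.restrict (ball c R)))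
      =ᵐ[volume.restrict (ball c R)] polyFun c p :=
  MemLp.coeFn_toLp (memLp_polyFun c R p)

theorem inner_harmonicToBergman_left (c : EuclideanSpace ℝ (Fin d)) (R : ℝ)
    (p : harmonicPolynomials d) (f : harmonicBergman (ball c R)) :
    ⟪harmonicToBergman c R p, f⟫_ℂ = ∫ y in ball c R,
      (f : Lp ℂ 2 (volume.restrict (ball c R))) y * polyFun c (polyConj (p : MvPolynomial (Fin d) ℂ)) y := by
  rw [Submodule.coe_inner, L2.inner_def]
  refine integral_congr_ae ?_
  filter_upwards [coeFn_harmonicToBergman c R p] with y hy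
  rw [hy, polyFun_polyConj]
  rfl

theorem inner_harmonicToBergman (c : EuclideanSpace ℝ (Fin d)) (R : ℝ)
    (p q : harmonicPolynomials d) :
    ⟪harmonicToBergman c R p, harmonicToBergman c R q⟫_ℂ =
      ∫ y in ball c R, polyFun c ((q : MvPolynomial (Fin d) ℂ) * polyConj (p : MvPolynomial (Fin d) ℂ)) y := by
  rw [inner_harmonicToBergman_left]
  refine integral_congr_ae ?_
  filter_upwards [coeFn_harmonicToBergman c R q] with y hy
  rw [hy, polyFun_mul]

theorem harmonicToBergman_injective (c : EuclideanSpace ℝ (Fin d)) {R : ℝ} (hR : 0 < R) :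
    Function.Injective (harmonicToBergman c R) := by
  rw [← LinearMap.ker_eq_bot, LinearMap.ker_eq_bot']
  intro p hp
  refine Subtype.ext (eq_zero_of_integral_ball_norm_sq_eq_zero (c := c) hR ?_)
  rw [← Complex.ofReal_eq_zero, ← integral_polyFun_mul_polyConj, ← inner_harmonicToBergman, hp,
    inner_zero_left]

theorem canonicalIdentification_harmonicToBergman {c : EuclideanSpace ℝ (Fin d)} {r R : ℝ}
    (h : ball c r ⊆ ball c R) (p : harmonicPolynomials d) :
    canonicalIdentification h (harmonicToBergman c R p) = harmonicToBergman c r p := by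
  refine Subtype.ext (Lp.ext ?_)
  have h1 : (harmonicToBergman c R p : Lp ℂ 2 (volume.restrict (ball c R)))
      =ᵐ[volume.restrict (ball c r)] polyFun c p :=
    ae_mono (Measure.restrict_mono h le_rfl) (coeFn_harmonicToBergman c R p)
  exact (MemLp.coeFn_toLp ((Lp.memLp (harmonicToBergman c R p :
    Lp ℂ 2 (volume.restrict (ball c R)))).mono_measure (Measure.restrict_mono h le_rfl))).trans
    (h1.trans (coeFn_harmonicToBergman c r p).symm)

theorem integral_ball_polyFun_eq (c : EuclideanSpace ℝ (Fin d)) (R : ℝ)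
    (p : MvPolynomial (Fin d) ℂ) :
    ∫ y in ball c R, polyFun c p y = ∫ y in ball 0 R, polyFun 0 p y := by
  rw [← integral_indicator measurableSet_ball, ← integral_indicator measurableSet_ball,
    ← integral_add_right_eq_self _ c]
  congr 1
  funext y
  by_cases hy : y ∈ ball (0 : EuclideanSpace ℝ (Fin d)) R
  · have hy' : y + c ∈ ball c R := by simpa [dist_eq_norm] using hy
    rw [Set.indicator_of_mem hy, Set.indicator_of_mem hy']
    simp [polyFun]
  · have hy' : y + c ∉ ball c R := by simpa [dist_eq_norm] using hy
    rw [Set.indicator_of_notMem hy, Set.indicator_of_notMem hy']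

theorem integral_ball_polyFun_scaling (c : EuclideanSpace ℝ (Fin d)) (r : ℝ) {γ : ℝ}
    (hγ : 0 < γ) {m : ℕ} {p : MvPolynomial (Fin d) ℂ} (hp : p.IsHomogeneous m) :
    ∫ y in ball c r, polyFun c p y =
      (((γ ^ (m + d))⁻¹ : ℝ) : ℂ) * ∫ y in ball c (γ * r), polyFun c p y := by
  rw [integral_ball_polyFun_eq, integral_ball_polyFun_eq c (γ * r)]
  have h := Measure.setIntegral_comp_smul_of_pos (volume : Measure (EuclideanSpace ℝ (Fin d)))
    (polyFun 0 p) (ball 0 r) hγ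
  simp_rw [polyFun_smul_of_isHomogeneous hp] at h
  rw [integral_const_mul, _root_.smul_ball hγ.ne', smul_zero, Real.norm_of_nonneg hγ.le,
    finrank_euclideanSpace_fin, Complex.real_smul] at h
  have hγ' : (γ : ℂ) ≠ 0 := Complex.ofReal_ne_zero.2 hγ.ne'
  rw [pow_add, mul_inv, Complex.ofReal_mul, mul_assoc, ← h]
  push_cast
  rw [inv_mul_cancel_left₀ (pow_ne_zero _ hγ')]

/-- The subspace of `h²` of a ball given by the homogeneous harmonic polynomials of degree `k`. -/
noncomputable def bergmanHomogeneous (c : EuclideanSpace ℝ (Fin d)) (R : ℝ) (k : ℕ) :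
    Submodule ℂ (harmonicBergman (ball c R)) :=
  LinearMap.range (harmonicToBergman c R ∘ₗ Submodule.inclusion
    (inf_le_left : harmonicPolynomials d ⊓ homogeneousSubmodule (Fin d) ℂ k ≤ _))

theorem mem_bergmanHomogeneous {c : EuclideanSpace ℝ (Fin d)} {R : ℝ} {k : ℕ}
    {f : harmonicBergman (ball c R)} : f ∈ bergmanHomogeneous c R k ↔
      ∃ p : harmonicPolynomials d, (p : MvPolynomial (Fin d) ℂ).IsHomogeneous k ∧
        harmonicToBergman c R p = f := by
  constructor
  · rintro ⟨p, rfl⟩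
    exact ⟨Submodule.inclusion inf_le_left p, p.2.2, rfl⟩
  · rintro ⟨p, hp, rfl⟩
    exact ⟨⟨p, p.2, hp⟩, rfl⟩

instance finiteDimensional_bergmanHomogeneous (c : EuclideanSpace ℝ (Fin d)) (R : ℝ) (k : ℕ) :
    FiniteDimensional ℂ (bergmanHomogeneous c R k) := by
  unfold bergmanHomogeneous
  infer_instance

theorem finrank_bergmanHomogeneous (hd : 1 ≤ d) (c : EuclideanSpace ℝ (Fin d)) {R : ℝ}
    (hR : 0 < R) (k : ℕ) : finrank ℂ (bergmanHomogeneous c R k) = sphericalHarmonicsDim d k := by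
  rw [← finrank_harmonicHomogeneous hd k, bergmanHomogeneous]
  exact LinearMap.finrank_range_of_inj
    ((harmonicToBergman_injective c hR).comp (Submodule.inclusion_injective _))

theorem polyLaplacian_polyConj_eq_zero (p : harmonicPolynomials d) :
    polyLaplacian d (polyConj (p : MvPolynomial (Fin d) ℂ)) = 0 := by
  rw [polyLaplacian_polyConj, mem_harmonicPolynomials_iff.1 p.2]
  exact map_zero _

theorem inner_harmonicToBergman_of_ne (c : EuclideanSpace ℝ (Fin d)) (R : ℝ) {k l : ℕ}
    (hkl : k ≠ l) {p q : harmonicPolynomials d} (hp : (p : MvPolynomial (Fin d) ℂ).IsHomogeneous k)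
    (hq : (q : MvPolynomial (Fin d) ℂ).IsHomogeneous l) :
    ⟪harmonicToBergman c R p, harmonicToBergman c R q⟫_ℂ = 0 := by
  rw [inner_harmonicToBergman]
  exact integral_ball_mul_eq_zero_of_isHomogeneous hkl.symm (mem_harmonicPolynomials_iff.1 q.2)
    (polyLaplacian_polyConj_eq_zero p) hq (hp.map _) c R

/-- The homogeneous harmonic polynomials of all degrees are total in `h²` of a ball. -/
theorem eq_zero_of_inner_bergmanHomogeneous (hd : 1 ≤ d) {c : EuclideanSpace ℝ (Fin d)} {R : ℝ}
    (hR : 0 < R) {f : harmonicBergman (ball c R)}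
    (h : ∀ k, ∀ p ∈ bergmanHomogeneous c R k, ⟪p, f⟫_ℂ = 0) : f = 0 := by
  obtain ⟨⟨f, u, hu, hfu⟩, rfl⟩ : ∃ g : harmonicBergman (ball c R), g = f := ⟨f, rfl⟩
  have : IsFiniteMeasure (volume.restrict (ball c R)) :=
    isFiniteMeasure_restrict.2 measure_ball_lt_top.ne
  have hui : IntegrableOn u (ball c R) :=
    ((Lp.memLp f).integrable one_le_two).congr hfu
  have hu2 : MemLp u 2 (volume.restrict (ball c R)) := (Lp.memLp f).ae_eq hfu
  refine Subtype.ext (Lp.ext ?_)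
  refine (hfu.trans ?_).trans (Lp.coeFn_zero _ _ _).symm
  refine ae_eq_zero_of_forall_integral_harmonic_eq_zero hd hR hu hui fun p hp => ?_
  have hmul : ∀ q, IntegrableOn (fun y => u y * polyFun c q y) (ball c R) := fun q =>
    hu2.integrable_mul (memLp_polyFun c R q)
  rw [← sum_homogeneousComponent p]
  simp_rw [polyFun_sum, Finset.mul_sum]
  rw [integral_finsetSum _ fun i _ => hmul _]
  refine Finset.sum_eq_zero fun k _ => ?_
  set q := homogeneousComponent k p with hq
  have hqh : polyLaplacian d q = 0 := polyLaplacian_homogeneousComponent k hp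
  have hconj : polyLaplacian d (polyConj q) = 0 := by
    rw [polyLaplacian_polyConj, hqh]
    exact map_zero _
  have hinner := h k (harmonicToBergman c R ⟨polyConj q, mem_harmonicPolynomials_iff.2 hconj⟩)
    (mem_bergmanHomogeneous.2 ⟨_, (homogeneousComponent_isHomogeneous k p).map _, rfl⟩)
  rw [inner_harmonicToBergman_left] at hinner
  rw [← hinner]
  refine integral_congr_ae (hfu.mono fun y hy => ?_)
  simp only [hy, polyFun_polyConj, Complex.conj_conj]

variable (d) in
/-- The ratio `γ ^ (-(2k + d))` of the squared norms over the balls of radii `r` and `γ r` of a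
homogeneous polynomial of degree `k`, as the square of the singular value `γ ^ (-(k + d / 2))`. -/
noncomputable def bergmanRatio (γ : ℝ) (k : ℕ) : ℝ := (γ ^ (-((k : ℝ) + (d : ℝ) / 2))) ^ 2

theorem bergmanRatio_eq {γ : ℝ} (hγ : 0 < γ) (k : ℕ) :
    bergmanRatio d γ k = (γ ^ (k + k + d))⁻¹ := by
  rw [bergmanRatio, ← Real.rpow_natCast, ← Real.rpow_mul hγ.le, ← Real.rpow_natCast,
    ← Real.rpow_neg hγ.le]
  congr 1
  push_cast
  ring

theorem bergmanRatio_pos {γ : ℝ} (hγ : 0 < γ) (k : ℕ) : 0 < bergmanRatio d γ k :=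
  pow_pos (Real.rpow_pos_of_pos hγ _) 2

theorem strictAnti_bergmanRatio {γ : ℝ} (hγ : 1 < γ) : StrictAnti (bergmanRatio d γ) := by
  intro k l hkl
  have hγ0 : 0 < γ := zero_lt_one.trans hγ
  rw [bergmanRatio_eq hγ0, bergmanRatio_eq hγ0]
  exact inv_strictAnti₀ (pow_pos hγ0 _) (pow_lt_pow_right₀ hγ (by omega))

theorem tendsto_bergmanRatio {γ : ℝ} (hγ : 1 < γ) :
    Tendsto (bergmanRatio d γ) atTop (𝓝 0) := by
  have hγ0 : 0 < γ := zero_lt_one.trans hγ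
  simp_rw [funext (bergmanRatio_eq (d := d) hγ0)]
  refine tendsto_inv_atTop_zero.comp ((tendsto_pow_atTop_atTop_of_one_lt hγ).comp ?_)
  exact tendsto_atTop_mono (f := fun k => k) (fun k => by omega) tendsto_id

theorem inner_harmonicToBergman_scaling (x : EuclideanSpace ℝ (Fin d)) {r R γ : ℝ} (hγ : 0 < γ)
    (hR : R = γ * r) {k : ℕ} {p q : harmonicPolynomials d}
    (hp : (p : MvPolynomial (Fin d) ℂ).IsHomogeneous k)
    (hq : (q : MvPolynomial (Fin d) ℂ).IsHomogeneous k) :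
    ⟪harmonicToBergman x r p, harmonicToBergman x r q⟫_ℂ =
      bergmanRatio d γ k * ⟪harmonicToBergman x R p, harmonicToBergman x R q⟫_ℂ := by
  have hp' : (polyConj (p : MvPolynomial (Fin d) ℂ)).IsHomogeneous k := hp.map _
  rw [inner_harmonicToBergman, inner_harmonicToBergman, bergmanRatio_eq hγ, hR]
  exact integral_ball_polyFun_scaling x r hγ (hq.mul hp')

set_option maxHeartbeats 400000 in
theorem inner_canonicalIdentification_bergmanHomogeneous {x : EuclideanSpace ℝ (Fin d)}
    {r R γ : ℝ} (hγ : 0 < γ) (hR : R = γ * r) (h : ball x r ⊆ ball x R) {k : ℕ}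
    {f g : harmonicBergman (ball x R)} (hf : f ∈ bergmanHomogeneous x R k)
    (hg : g ∈ bergmanHomogeneous x R k) :
    ⟪canonicalIdentification h f, canonicalIdentification h g⟫_ℂ =
      bergmanRatio d γ k * ⟪f, g⟫_ℂ := by
  obtain ⟨p, hp, hpf⟩ := mem_bergmanHomogeneous.1 hf
  obtain ⟨q, hq, hqg⟩ := mem_bergmanHomogeneous.1 hg
  rw [← hpf, ← hqg, canonicalIdentification_harmonicToBergman, canonicalIdentification_harmonicToBergman]
  exact inner_harmonicToBergman_scaling x hγ hR hp hq

theorem inner_canonicalIdentification_bergmanHomogeneous_of_ne {x : EuclideanSpace ℝ (Fin d)}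
    {r R : ℝ} (h : ball x r ⊆ ball x R) {k l : ℕ} (hkl : k ≠ l) {f g : harmonicBergman (ball x R)}
    (hf : f ∈ bergmanHomogeneous x R k) (hg : g ∈ bergmanHomogeneous x R l) :
    ⟪canonicalIdentification h f, canonicalIdentification h g⟫_ℂ = 0 := by
  obtain ⟨p, hp, hpf⟩ := mem_bergmanHomogeneous.1 hf
  obtain ⟨q, hq, hqg⟩ := mem_bergmanHomogeneous.1 hg
  rw [← hpf, ← hqg, canonicalIdentification_harmonicToBergman, canonicalIdentification_harmonicToBergman]
  exact inner_harmonicToBergman_of_ne x _ hkl hp hq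

theorem inner_bergmanHomogeneous_of_ne {x : EuclideanSpace ℝ (Fin d)} {R : ℝ} {k l : ℕ}
    (hkl : k ≠ l) {f g : harmonicBergman (ball x R)} (hf : f ∈ bergmanHomogeneous x R k)
    (hg : g ∈ bergmanHomogeneous x R l) : ⟪f, g⟫_ℂ = 0 := by
  obtain ⟨p, hp, hpf⟩ := mem_bergmanHomogeneous.1 hf
  obtain ⟨q, hq, hqg⟩ := mem_bergmanHomogeneous.1 hg
  rw [← hpf, ← hqg]
  exact inner_harmonicToBergman_of_ne x _ hkl hp hq

/-- Restriction to a concentric ball is diagonal for the spaces of homogeneous harmonic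
polynomials. -/
theorem isDiagonalFor_canonicalIdentification (hd : 1 ≤ d) {x : EuclideanSpace ℝ (Fin d)}
    {r γ : ℝ} (hr : 0 < r) (hγ : 1 < γ) (h : ball x r ⊆ ball x (γ * r)) :
    IsDiagonalFor (canonicalIdentification h) (bergmanHomogeneous x (γ * r))
      (bergmanRatio d γ) where
  finite _ := inferInstance
  orthogonal _ _ hkl _ hf _ hg := inner_bergmanHomogeneous_of_ne hkl hf hg
  total _ hf := eq_zero_of_inner_bergmanHomogeneous hd (mul_pos (zero_lt_one.trans hγ) hr) hf
  inner_map _ _ hf _ hg :=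
    inner_canonicalIdentification_bergmanHomogeneous (zero_lt_one.trans hγ) rfl h hf hg
  inner_map_ne _ _ hkl _ hf _ hg :=
    inner_canonicalIdentification_bergmanHomogeneous_of_ne h hkl hf hg

end Bergman

/-! ### The singular values -/

section SingularValues

open Module

/-- For positive distinct weights, the eigenvalues of `J* J` are the weights, with the dimensions of
the subspaces as multiplicities. -/
theorem IsDiagonalFor.isEigenvalueSequence_iff {H₁ H₂ : Type*} [NormedAddCommGroup H₁]
    [InnerProductSpace ℂ H₁] [CompleteSpace H₁] [NormedAddCommGroup H₂] [InnerProductSpace ℂ H₂]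
    [CompleteSpace H₂] {J : H₁ →L[ℂ] H₂} {V : ℕ → Submodule ℂ H₁} {c : ℕ → ℝ}
    (h : IsDiagonalFor J V c) (hc : Function.Injective c) (hpos : ∀ k, 0 < c k) (l : ℕ+ → ℂ) :
    IsEigenvalueSequence (ContinuousLinearMap.adjoint J ∘L J) l ↔
      Antitone (fun n => ‖l n‖) ∧ (∀ k, {n | l n = c k}.encard = finrank ℂ (V k)) ∧
        ∀ n, l n ≠ 0 → ∃ k, l n = c k := by
  have hfin := h.finite
  have hrank : ∀ k, Cardinal.toENat (Module.rank ℂ (End.maxGenEigenspace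
      ((ContinuousLinearMap.adjoint J ∘L J : H₁ →L[ℂ] H₁) : H₁ →ₗ[ℂ] H₁) (c k))) =
        finrank ℂ (V k) := by
    intro k
    rw [h.maxGenEigenspace_eq hc, ← finrank_eq_rank]
    simp
  have hrank0 : ∀ μ : ℂ, (∀ k, μ ≠ c k) → Cardinal.toENat (Module.rank ℂ (End.maxGenEigenspace
      ((ContinuousLinearMap.adjoint J ∘L J : H₁ →L[ℂ] H₁) : H₁ →ₗ[ℂ] H₁) μ)) = 0 := by
    intro μ hμ
    rw [h.maxGenEigenspace_eq_bot hμ, rank_bot, map_zero]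
  refine and_congr_right fun _ => ⟨fun hl => ⟨fun k => ?_, fun n hn => ?_⟩, fun hl μ hμ => ?_⟩
  · rw [hl _ (Complex.ofReal_ne_zero.2 (hpos k).ne'), hrank]
  · by_contra! hne
    have h1 := hl (l n) hn
    rw [hrank0 _ hne, Set.encard_eq_zero] at h1
    exact Set.eq_empty_iff_forall_notMem.1 h1 n rfl
  · by_cases hμk : ∃ k, μ = c k
    · obtain ⟨k, rfl⟩ := hμk
      rw [hrank, hl.1 k]
    · push Not at hμk
      rw [hrank0 μ hμk, Set.encard_eq_zero, Set.eq_empty_iff_forall_notMem]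
      rintro n rfl
      obtain ⟨k, hk⟩ := hl.2 n hμ
      exact hμk k hk

theorem sum_range_sphericalHarmonicsDim_one (k : ℕ) :
    ∑ j ∈ Finset.range k, sphericalHarmonicsDim 1 j = min k 2 := by
  induction k with
  | zero => simp
  | succ k ih =>
    rw [Finset.sum_range_succ, ih, sphericalHarmonicsDim_one]
    split_ifs <;> omega

theorem le_sum_range_sphericalHarmonicsDim {d : ℕ} (hd : 2 ≤ d) (k : ℕ) :
    k ≤ ∑ j ∈ Finset.range k, sphericalHarmonicsDim d j := by
  simpa using Finset.card_nsmul_le_sum (Finset.range k) (sphericalHarmonicsDim d) 1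
    fun j _ => sphericalHarmonicsDim_pos hd j

/-- The ranges `h_d(k - 1) < n ≤ h_d(k)` cover all indices for `d ≥ 2`, and the first two for
`d = 1`. -/
theorem exists_degree_iff {d : ℕ} (hd : 1 ≤ d) (n : ℕ+) :
    (∃ k : ℕ, ∑ j ∈ Finset.range k, sphericalHarmonicsDim d j < n ∧
      (n : ℕ) ≤ ∑ j ∈ Finset.range (k + 1), sphericalHarmonicsDim d j) ↔
      (2 ≤ d ∨ (n : ℕ) ≤ 2) := by
  classical
  constructor
  · rintro ⟨k, -, hk⟩
    by_contra! hn
    obtain rfl : d = 1 := by omega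
    rw [sum_range_sphericalHarmonicsDim_one] at hk
    omega
  · intro hn
    have hex : ∃ k, (n : ℕ) ≤ ∑ j ∈ Finset.range k, sphericalHarmonicsDim d j := by
      rcases hd.lt_or_eq with h2 | rfl
      · exact ⟨n, le_sum_range_sphericalHarmonicsDim h2 n⟩
      · refine ⟨2, ?_⟩
        rw [sum_range_sphericalHarmonicsDim_one]
        omega
    obtain ⟨k, hk⟩ : ∃ k, Nat.find hex = k + 1 := by
      refine Nat.exists_eq_succ_of_ne_zero fun h0 => ?_
      have := Nat.find_spec hex
      rw [h0] at this
      simp at this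
    refine ⟨k, not_le.1 (Nat.find_min hex (by omega)), ?_⟩
    rw [← hk]
    exact Nat.find_spec hex

end SingularValues

theorem mainTheorem4 (d : ℕ) (hd : 1 ≤ d) (x : EuclideanSpace ℝ (Fin d)) (r γ : ℝ)
    (hr : 0 < r) (hγ : 1 < γ) :
    -- the two harmonic Bergman spaces are Hilbert spaces
    ∃ (_ : CompleteSpace (harmonicBergman (Metric.ball x (γ * r))))
      (_ : CompleteSpace (harmonicBergman (Metric.ball x r))),
      -- `J` is compact and has a sequence of singular values
      (∃ s : ℕ+ → ℝ, IsSingularValueSequence (canonicalIdentification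
        (Metric.ball_subset_ball (x := x) (le_mul_of_one_le_left hr.le hγ.le))) s) ∧
      (∀ s : ℕ+ → ℝ, IsSingularValueSequence (canonicalIdentification
        (Metric.ball_subset_ball (x := x) (le_mul_of_one_le_left hr.le hγ.le))) s →
        -- the values of the sequence
        (∀ (k : ℕ) (n : ℕ+), harmonicDim d ((k : ℤ) - 1) < n → (n : ℕ) ≤ harmonicDim d k →
          s n = γ ^ (-((k : ℝ) + (d : ℝ) / 2))) ∧
        -- every index occurs above, except that `J` has rank two for `d = 1`
        (∀ n : ℕ+, (∃ k : ℕ, harmonicDim d ((k : ℤ) - 1) < n ∧ (n : ℕ) ≤ harmonicDim d k) ↔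
          (2 ≤ d ∨ (n : ℕ) ≤ 2)) ∧
        (d = 1 → ∀ n : ℕ+, 2 < (n : ℕ) → s n = 0) ∧
        -- the multiplicities
        (∀ k : ℕ, {n : ℕ+ | s n = γ ^ (-((k : ℝ) + (d : ℝ) / 2))}.encard =
          (sphericalHarmonicsDim d k : ℕ∞))) ∧
      -- the dimension of the space of harmonic polynomials of degree at most `k`
      (∀ k : ℕ, Module.finrank ℂ
          ↥(harmonicPolynomials d ⊓ MvPolynomial.restrictTotalDegree (Fin d) ℂ k) =
        harmonicDim d k) := by
  have hγ0 : 0 < γ := zero_lt_one.trans hγ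
  have hc1 : CompleteSpace (harmonicBergman (Metric.ball x (γ * r))) :=
    completeSpace_harmonicBergman Metric.isOpen_ball
  have hc2 : CompleteSpace (harmonicBergman (Metric.ball x r)) :=
    completeSpace_harmonicBergman Metric.isOpen_ball
  refine ⟨hc1, hc2, ?_, ?_, finrank_harmonicPolynomials_inf_restrictTotalDegree hd⟩
  all_goals
    have hJ := isDiagonalFor_canonicalIdentification hd hr hγ
      (Metric.ball_subset_ball (x := x) (le_mul_of_one_le_left hr.le hγ.le))
    have hanti := strictAnti_bergmanRatio (d := d) hγ
    have hpos := bergmanRatio_pos (d := d) hγ0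
    have hiff := hJ.isEigenvalueSequence_iff hanti.injective hpos
    simp only [finrank_bergmanHomogeneous hd x (mul_pos hγ0 hr)] at hiff
  · obtain ⟨l, hl, hl0, hlN, hlc⟩ :=
      exists_sequence_with_multiplicities (sphericalHarmonicsDim d) hanti hpos
    refine ⟨fun n => √(l n), hJ.isCompactOperator hanti.antitone (tendsto_bergmanRatio hγ),
      fun n => (l n : ℂ), (hiff _).2 ⟨fun m n hmn => ?_, fun k => ?_, fun n hn => ?_⟩,
      fun n => ⟨Real.sqrt_nonneg _, ?_⟩⟩
    · simpa [abs_of_nonneg (hl0 _)] using hl hmn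
    · simpa using hlN k
    · obtain ⟨k, hk⟩ := hlc n (by simpa using hn)
      exact ⟨k, congrArg _ hk⟩
    · rw [← Complex.ofReal_pow, Real.sq_sqrt (hl0 n)]
  · rintro s ⟨-, l, hl, hs⟩
    obtain ⟨hlanti, hlN, hlc⟩ := (hiff l).1 hl
    have hdim : ∀ k : ℕ, harmonicDim d k =
        ∑ j ∈ Finset.range (k + 1), sphericalHarmonicsDim d j := fun k => rfl
    have hdim' : ∀ k : ℕ, harmonicDim d ((k : ℤ) - 1) =
        ∑ j ∈ Finset.range k, sphericalHarmonicsDim d j := fun k => by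
      rw [harmonicDim, sub_add_cancel, Int.toNat_natCast]
    -- `s n` is the nonnegative root of `l n`
    have hsl : ∀ (n : ℕ+) (k : ℕ), s n = γ ^ (-((k : ℝ) + (d : ℝ) / 2)) ↔ l n = bergmanRatio d γ k := by
      intro n k
      rw [← (hs n).2, bergmanRatio, Complex.ofReal_pow, ← Complex.ofReal_pow, ← Complex.ofReal_pow,
        Complex.ofReal_inj, sq_eq_sq₀ (hs n).1 (Real.rpow_nonneg hγ0.le _)]
    simp only [hdim, hdim', hsl]
    refine ⟨fun k n h1 h2 => eq_of_multiplicities hanti hpos hlanti hlN hlc h1 h2,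
      exists_degree_iff hd, ?_, hlN⟩
    rintro rfl n hn
    by_contra hsn
    have hln : l n ≠ 0 := by
      rw [← (hs n).2]
      exact pow_ne_zero 2 (Complex.ofReal_ne_zero.2 hsn)
    obtain ⟨k, hk⟩ := hlc n hln
    have hnorm : bergmanRatio 1 γ k ≤ ‖l n‖ := by
      rw [hk, Complex.norm_real, Real.norm_of_nonneg (hpos k).le]
    have := (le_norm_iff_of_multiplicities hanti hpos hlanti hlN hlc k n).1 hnorm
    rw [sum_range_sphericalHarmonicsDim_one] at this
    omega
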